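/- Let $0,1,2,3,1',2',3'$ be an orthonormal basis of $\mathbb R^7=\mathbb R\oplus\mathbb C^3$ with $0\in\mathbb R$ and $i\,1=1'$, $i\,2=2'$, $i\,3=3'$, let $U(3)\leqslant SO(7)$ be the subgroup fixing $0$ and acting complex linearly on $\mathbb C^3$, and let $M=SO(7)/U(3)$ be the twistor space of $S^6$. Write $ij=i\wedge j\in\Lambda^2\mathbb R^7=\mathfrak{so}(7)$ and put $$A=01,\ B=02,\ C=03,\quad A'=01',\ B'=02',\ C'=03',$$ $$P=23-2'3',\ Q=31-3'1',\ R=12-1'2',\quad P'=23'-32',\ Q'=31'-13',\ R'=12'-21'.$$ These are a basis of the orthogonal complement $\mathfrak m\cong T_{\mathrm{Id}\,U(3)}M$ of $\mathfrak u(3)$ in $\mathfrak{so}(7)$. Let $a,b,c,a',b',c',p,q,r,p',q',r'$ be the dual basis, regarded as left-invariant one-forms on $SO(7)$ that vanish on $\mathfrak u(3)$, and let $\mathfrak S$ denote the sum over the cyclic permutations $(a,a',p,p')\to(b,b',q,q')\to(c,c',r,r')\to(a,a',p,p')$. For $\lambda,\mu\in\mathbb R$ put $$\omega_0=\mathfrak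 S\,a'\wedge a,\quad \tilde\omega_0=\mathfrak S\,p'\wedge p,\quad \omega_I=\lambda\omega_0+\mu\tilde\omega_0,\quad \omega_J+i\omega_K=\mathfrak S\,(p+ip')\wedge(a+ia'),$$ $$g_{\lambda,\mu}=\mathfrak S\bigl(\lambda(a^2+a'^2)+\mu(p^2+p'^2)\bigr).$$ Here $\omega_I$ and $g_{\lambda,\mu}$ descend to $M$, while $\omega_J,\omega_K$ descend to $SO(7)/SU(3)$ and define local forms on $M$ by means of local sections of $SO(7)/SU(3)\to M$. An almost quaternion-Hermitian structure on $M$ is a Riemannian metric $g$ together with a rank-three subbundle $\mathcal G\subset\mathrm{End}(TM)$ that locally has a smooth basis $I,J,K$ with $I^2=-1=J^2$, $IJ=K=-JI$ and $g(I\cdot,I\cdot)=g=g(J\cdot,J\cdot)$. A metric on $M$ has normalised volume if its volume density takes the value $1$ on the frame $A,\dots,R'$ and on all its $SO(7)$-translates. Say that an almost quaternion-Hermitian structure $(g,\mathcal G)$ is given by $(\lambda,\mu)$ if $g=g_{\lambda,\mu}$ and, at each point and for each choice of the lift to $SO(7)$, the fibre of $\mathcal G$ is spanned by the endomorphisms $I,J,K$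 with $\omega_I=g(\cdot,I\cdot)$, $\omega_J=g(\cdot,J\cdot)$, $\omega_K=g(\cdot,K\cdot)$, these satisfying the quaternion identities and compatibility conditions above. Then: 1. There is an almost quaternion-Hermitian structure given by $(\lambda,\mu)$ if and only if $\lambda>0$, $\mu>0$ and $\lambda\mu=1$, and it is then unique. 2. An almost quaternion-Hermitian structure on $M$ is $SO(7)$-invariant with normalised volume if and only if it is given by some $(\lambda,\mu)$ with $\lambda,\mu>0$ and $\lambda\mu=1$. 3. A Riemannian metric on $M$ is $SO(7)$-invariant with normalised volume if and only if it equals $g_{\lambda,\mu}$ for some $\lambda,\mu>0$ with $\lambda\mu=1$; each such $g_{\lambda,\mu}$ exists on $M$, and $(\lambda,\mu)$ is determined by the metric. -/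

import Mathlib

open scoped Matrix Matrix.Norms.Elementwise ContDiff

noncomputable section

namespace TwistorS6

/-! ### The groups and the homogeneous space

The orthonormal basis `0, 1, 2, 3, 1', 2', 3'` of `ℝ⁷ = ℝ ⊕ ℂ³` is indexed by
`0, 1, 2, 3, 4, 5, 6 : Fin 7`, so that `1' = 4`, `2' = 5`, `3' = 6`. -/

abbrev Mat := Matrix (Fin 7) (Fin 7) ℝ

abbrev SO7 := Matrix.specialOrthogonalGroup (Fin 7) ℝ

/-- The element `i ∧ j` of `so(7) = Λ²ℝ⁷`: the skew matrix sending `eᵢ` to `eⱼ` and `eⱼ` to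
`-eᵢ`. -/
def wedge (i j : Fin 7) : Mat := Matrix.single j i 1 - Matrix.single i j 1

/-- `E = 11' + 22' + 33'`. This is multiplication by `i` on `ℂ³`, extended by zero to `ℝ⁷`. -/
def matE : Mat := wedge 1 4 + wedge 2 5 + wedge 3 6

/-- `U(3)`, as the subgroup of `SO(7)` that fixes the basis vector `0` and acts complex
linearly on `ℂ³`. -/
def U3 : Subgroup SO7 where
  carrier := {a | (a : Mat) *ᵥ Pi.single 0 1 = Pi.single 0 1 ∧ (a : Mat) * matE = matE * (a : Mat)}
  one_mem' := ⟨Matrix.one_mulVec _, by rw [Submonoid.coe_one, one_mul, mul_one]⟩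
  mul_mem' := by
    rintro a b ⟨ha, ha'⟩ ⟨hb, hb'⟩
    refine ⟨?_, ?_⟩
    · rw [Submonoid.coe_mul, ← Matrix.mulVec_mulVec, hb, ha]
    · rw [Submonoid.coe_mul, mul_assoc, hb', ← mul_assoc, ha', mul_assoc]
  inv_mem' := by
    rintro a ⟨ha, ha'⟩
    have h1 : ((a⁻¹ : SO7) : Mat) * (a : Mat) = 1 := by
      rw [← Submonoid.coe_mul, inv_mul_cancel, Submonoid.coe_one]
    have h2 : (a : Mat) * ((a⁻¹ : SO7) : Mat) = 1 := by
      rw [← Submonoid.coe_mul, mul_inv_cancel, Submonoid.coe_one]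
    refine ⟨?_, ?_⟩
    · conv_lhs => rw [← ha]
      rw [Matrix.mulVec_mulVec, h1, Matrix.one_mulVec]
    · calc ((a⁻¹ : SO7) : Mat) * matE
          = ((a⁻¹ : SO7) : Mat) * matE * ((a : Mat) * ((a⁻¹ : SO7) : Mat)) := by rw [h2, mul_one]
        _ = ((a⁻¹ : SO7) : Mat) * (matE * (a : Mat)) * ((a⁻¹ : SO7) : Mat) := by
          simp only [mul_assoc]
        _ = (((a⁻¹ : SO7) : Mat) * (a : Mat)) * matE * ((a⁻¹ : SO7) : Mat) := by
          rw [← ha']; simp only [mul_assoc]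
        _ = matE * ((a⁻¹ : SO7) : Mat) := by rw [h1, one_mul]

/-- The twistor space `M = SO(7)/U(3)` of the six-sphere. -/
abbrev M := SO7 ⧸ U3

/-- The adjoint action `X ↦ a X a⁻¹`. -/
def Ad (a : SO7) : Mat →ₗ[ℝ] Mat where
  toFun X := (a : Mat) * X * ((a⁻¹ : SO7) : Mat)
  map_add' X Y := by rw [mul_add, add_mul]
  map_smul' c X := by simp

theorem Ad_mul (a b : SO7) (X : Mat) : Ad (a * b) X = Ad a (Ad b X) := by
  simp only [Ad, LinearMap.coe_mk, AddHom.coe_mk, Submonoid.coe_mul, mul_inv_rev, mul_assoc]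

theorem Ad_one (X : Mat) : Ad 1 X = X := by
  simp [Ad]

theorem Ad_inv_self (a : SO7) (X : Mat) : Ad a⁻¹ (Ad a X) = X := by
  rw [← Ad_mul, inv_mul_cancel, Ad_one]

theorem Ad_self_inv (a : SO7) (X : Mat) : Ad a (Ad a⁻¹ X) = X := by
  rw [← Ad_mul, mul_inv_cancel, Ad_one]

theorem trace_Ad_mul (a : SO7) (X Y : Mat) : (Ad a X * Y).trace = (X * Ad a⁻¹ Y).trace := by
  simp only [Ad, LinearMap.coe_mk, AddHom.coe_mk, inv_inv]
  rw [mul_assoc, mul_assoc, Matrix.trace_mul_comm]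
  simp only [mul_assoc]

theorem transpose_Ad (a : SO7) (X : Mat) : (Ad a X)ᵀ = Ad a Xᵀ := by
  have h : ((a⁻¹ : SO7) : Mat) = (a : Mat)ᵀ := rfl
  simp only [Ad, LinearMap.coe_mk, AddHom.coe_mk, h, Matrix.transpose_mul,
    Matrix.transpose_transpose, mul_assoc]

/-! ### The tangent bundle

The tangent bundle of `M` is the bundle `SO(7) ×_{U(3)} 𝔪` associated to the isotropy
representation `𝔪 ≅ so(7)/u(3)`, where `𝔪` is the `Ad U(3)`-invariant complement of `u(3)` that
is orthogonal to it for the trace form. The fibre at `aU(3)` is `Ad_a 𝔪`. -/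

/-- `u(3)`: the skew matrices that kill the basis vector `0` and are complex linear on `ℂ³`. -/
def u3 : Submodule ℝ Mat where
  carrier := {Y | Yᵀ = -Y ∧ Y *ᵥ Pi.single 0 1 = 0 ∧ Y * matE = matE * Y}
  zero_mem' := ⟨by simp, Matrix.zero_mulVec _, by simp⟩
  add_mem' := by
    rintro X Y ⟨h1, h2, h3⟩ ⟨k1, k2, k3⟩
    refine ⟨?_, ?_, ?_⟩
    · rw [Matrix.transpose_add, h1, k1, neg_add]
    · rw [Matrix.add_mulVec, h2, k2, add_zero]
    · rw [add_mul, mul_add, h3, k3]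
  smul_mem' := by
    rintro c X ⟨h1, h2, h3⟩
    refine ⟨?_, ?_, ?_⟩
    · rw [Matrix.transpose_smul, h1, smul_neg]
    · rw [Matrix.smul_mulVec, h2, smul_zero]
    · rw [smul_mul_assoc, mul_smul_comm, h3]

/-- The orthogonal complement `𝔪` of `u(3)` in `so(7)`: the tangent space of `M` at the base
point `U(3)`. -/
def mSpace : Submodule ℝ Mat where
  carrier := {X | Xᵀ = -X ∧ ∀ Y ∈ u3, (X * Y).trace = 0}
  zero_mem' := by simp
  add_mem' := by
    rintro X Y ⟨h1, h2⟩ ⟨k1, k2⟩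
    refine ⟨?_, fun Z hZ => ?_⟩
    · rw [Matrix.transpose_add, h1, k1, neg_add]
    · rw [add_mul, Matrix.trace_add, h2 Z hZ, k2 Z hZ, add_zero]
  smul_mem' := by
    rintro c X ⟨h1, h2⟩
    refine ⟨?_, fun Z hZ => ?_⟩
    · rw [Matrix.transpose_smul, h1, smul_neg]
    · rw [smul_mul_assoc, Matrix.trace_smul, h2 Z hZ, smul_zero]

theorem Ad_mem_u3 {h : SO7} (hh : h ∈ U3) {Y : Mat} (hY : Y ∈ u3) : Ad h Y ∈ u3 := by
  obtain ⟨h1, h2, h3⟩ := hY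
  obtain ⟨i1, i2⟩ := U3.inv_mem hh
  obtain ⟨-, k2⟩ := hh
  refine ⟨?_, ?_, ?_⟩
  · rw [transpose_Ad, h1, map_neg]
  · simp only [Ad, LinearMap.coe_mk, AddHom.coe_mk]
    rw [← Matrix.mulVec_mulVec, i1, ← Matrix.mulVec_mulVec, h2, Matrix.mulVec_zero]
  · simp only [Ad, LinearMap.coe_mk, AddHom.coe_mk]
    rw [mul_assoc, i2, ← mul_assoc, mul_assoc (h : Mat) Y, h3, ← mul_assoc, k2]
    simp only [mul_assoc]

theorem Ad_mem_mSpace {h : SO7} (hh : h ∈ U3) {X : Mat} (hX : X ∈ mSpace) :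
    Ad h X ∈ mSpace := by
  refine ⟨?_, fun Y hY => ?_⟩
  · rw [transpose_Ad, hX.1, map_neg]
  · rw [trace_Ad_mul]
    exact hX.2 _ (Ad_mem_u3 (U3.inv_mem hh) hY)

/-- The tangent space of `M` at `m`; it is `Ad_a 𝔪` for every `a` with `m = aU(3)`, see
`Ad_mem_tangent`. -/
def T (m : M) : Submodule ℝ Mat where
  carrier := {X | ∀ a : SO7, (a : M) = m → Ad a⁻¹ X ∈ mSpace}
  zero_mem' := fun a _ => by rw [map_zero]; exact mSpace.zero_mem
  add_mem' := fun h k a ha => by rw [map_add]; exact mSpace.add_mem (h a ha) (k a ha)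
  smul_mem' := fun c X h a ha => by rw [map_smul]; exact mSpace.smul_mem c (h a ha)

theorem Ad_mem_tangent (a : SO7) {X : Mat} (hX : X ∈ mSpace) : Ad a X ∈ T (a : M) := by
  intro b hb
  rw [← Ad_mul]
  exact Ad_mem_mSpace (QuotientGroup.eq.1 hb) hX

theorem Ad_mem_tangent_smul (h : SO7) {m : M} {X : Mat} (hX : X ∈ T m) :
    Ad h X ∈ T (h • m) := by
  intro b hb
  have hb' : ((h⁻¹ * b : SO7) : M) = m := by
    rw [← smul_eq_mul, ← MulAction.Quotient.smul_coe, hb, inv_smul_smul]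
  have := hX _ hb'
  rwa [mul_inv_rev, inv_inv, Ad_mul] at this

theorem Ad_inv_mem_tangent (h : SO7) {m : M} {X : Mat} (hX : X ∈ T (h • m)) :
    Ad h⁻¹ X ∈ T m := by
  have := Ad_mem_tangent_smul h⁻¹ hX
  rwa [inv_smul_smul] at this

/-- The differential `T_m M → T_{hm} M` of the action of `h ∈ SO(7)` on `M`. -/
def push (h : SO7) (m : M) : T m ≃ₗ[ℝ] T (h • m) where
  toFun X := ⟨Ad h X, Ad_mem_tangent_smul h X.2⟩
  invFun X := ⟨Ad h⁻¹ X, Ad_inv_mem_tangent h X.2⟩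
  map_add' X Y := Subtype.ext (map_add (Ad h) (X : Mat) Y)
  map_smul' c X := Subtype.ext (map_smul (Ad h) c (X : Mat))
  left_inv X := Subtype.ext (Ad_inv_self h X)
  right_inv X := Subtype.ext (Ad_self_inv h X)

/-! ### The standard basis of `𝔪` and its dual basis -/

/-- The basis `A, B, C`; `A', B', C'`; `P, Q, R`; `P', Q', R'` of `𝔪`. -/
def basisM : Fin 4 × Fin 3 → Mat := fun i =>
  ![![wedge 0 1, wedge 0 2, wedge 0 3],
    ![wedge 0 4, wedge 0 5, wedge 0 6],
    ![wedge 2 3 - wedge 5 6, wedge 3 1 - wedge 6 4, wedge 1 2 - wedge 4 5],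
    ![wedge 2 6 - wedge 3 5, wedge 3 4 - wedge 1 6, wedge 1 5 - wedge 2 4]] i.1 i.2

/-- The one-forms `a, b, c`; `a', b', c'`; `p, q, r`; `p', q', r'` dual to `basisM`, as functions
on `so(7)` that vanish on `u(3)`. -/
def coM (i : Fin 4 × Fin 3) (X : Mat) : ℝ :=
  ![![X 1 0, X 2 0, X 3 0],
    ![X 4 0, X 5 0, X 6 0],
    ![(X 3 2 - X 6 5) / 2, (X 1 3 - X 4 6) / 2, (X 2 1 - X 5 4) / 2],
    ![(X 6 2 - X 5 3) / 2, (X 4 3 - X 6 1) / 2, (X 5 1 - X 4 2) / 2]] i.1 i.2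

theorem wedge_apply (a b i j : Fin 7) :
    wedge a b i j = (if i = b ∧ j = a then 1 else 0) - (if i = a ∧ j = b then 1 else 0) := by
  simp only [wedge, Matrix.sub_apply, Matrix.single_apply, eq_comm]

theorem mul_wedge_apply (Y : Mat) (a b i j : Fin 7) :
    (Y * wedge a b) i j = (if j = a then Y i b else 0) - (if j = b then Y i a else 0) := by
  simp [wedge, mul_sub, Matrix.mul_apply, Matrix.single_apply, ite_and, eq_comm]

theorem wedge_mul_apply (Y : Mat) (a b i j : Fin 7) :
    (wedge a b * Y) i j = (if i = b then Y a j else 0) - (if i = a then Y b j else 0) := by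
  simp [wedge, sub_mul, Matrix.mul_apply, Matrix.single_apply, ite_and, eq_comm]

theorem trace_wedge_mul (i j : Fin 7) (Y : Mat) : (wedge i j * Y).trace = Y i j - Y j i := by
  simp [wedge, sub_mul, Matrix.trace_sub, Matrix.trace_single_mul]

theorem transpose_wedge (i j : Fin 7) : (wedge i j)ᵀ = -wedge i j := by
  simp [wedge, Matrix.transpose_sub, Matrix.transpose_single]

theorem basisM_mem (i : Fin 4 × Fin 3) : basisM i ∈ mSpace := by
  refine ⟨?_, fun Y hY => ?_⟩
  · obtain ⟨i, k⟩ := i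
    fin_cases i <;> fin_cases k <;>
      simp [basisM, Matrix.transpose_sub, transpose_wedge] <;> abel
  · obtain ⟨h1, h2, h3⟩ := hY
    have hs : ∀ i j, Y j i = -Y i j := fun i j => congrFun (congrFun h1 i) j
    have h0 : ∀ i, Y i 0 = 0 := fun i => by simpa using congrFun h2 i
    have hE : ∀ i j, (Y * matE) i j = (matE * Y) i j := fun i j => by rw [h3]
    simp only [matE, mul_add, add_mul, Matrix.add_apply, mul_wedge_apply, wedge_mul_apply] at hE
    have e1 := hE 1 5
    have e2 := hE 1 6
    have e3 := hE 2 6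
    have f1 := hE 1 2
    have f2 := hE 1 3
    have f3 := hE 2 3
    simp at e1 e2 e3 f1 f2 f3
    obtain ⟨i, k⟩ := i
    fin_cases i <;> fin_cases k <;>
      simp [basisM, sub_mul, trace_wedge_mul]
    all_goals
      linarith [h0 1, h0 2, h0 3, h0 4, h0 5, h0 6, hs 0 1, hs 0 2, hs 0 3, hs 0 4, hs 0 5,
        hs 0 6, hs 1 2, hs 1 3, hs 2 3, hs 4 5, hs 4 6, hs 5 6, hs 1 5, hs 1 6, hs 2 4, hs 2 6,
        hs 3 4, hs 3 5]

/-- `Ad_a` of the standard basis of `𝔪`: a basis of the tangent space at `aU(3)`. -/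
def frame (a : SO7) (i : Fin 4 × Fin 3) : T (a : M) :=
  ⟨Ad a (basisM i), Ad_mem_tangent a (basisM_mem i)⟩

/-! ### Smoothness -/

/-- Smoothness of a function on `W ⊆ SO(7)`: it extends locally to a smooth function of the
matrix entries. Here `SO(7)` is regarded as a submanifold of the space of matrices. -/
def SmoothOn {V : Type*} [NormedAddCommGroup V] [NormedSpace ℝ V] (f : SO7 → V) (W : Set SO7) :
    Prop :=
  ∀ a ∈ W, ∃ (O : Set Mat) (F : Mat → V), IsOpen O ∧ (a : Mat) ∈ O ∧ ContDiffOn ℝ ∞ F O ∧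
    ∀ b ∈ W, (b : Mat) ∈ O → f b = F b

/-- A field of endomorphisms of `TM` is smooth over `U ⊆ M` if its pull-back to `SO(7)` maps the
smooth frame of the pull-back of `TM` to smooth sections. -/
def SmoothEndOn (I : ∀ m : M, Module.End ℝ (T m)) (U : Set M) : Prop :=
  ∀ i, SmoothOn (fun a : SO7 => ((I (a : M) (frame a i) : T (a : M)) : Mat))
    ((fun a : SO7 => (a : M)) ⁻¹' U)

/-! ### Metrics and almost quaternion-Hermitian structures -/

/-- A (smooth) Riemannian metric on `M`. -/
@[ext] structure RiemMetric where
  inner : ∀ m : M, LinearMap.BilinForm ℝ (T m)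
  symm : ∀ m X Y, inner m X Y = inner m Y X
  pos : ∀ m X, X ≠ 0 → 0 < inner m X X
  smooth : ∀ i j, SmoothOn (fun a : SO7 => inner (a : M) (frame a i) (frame a j)) Set.univ

/-- Invariance of a metric under the action of `SO(7)` on `M`. -/
def RiemMetric.IsInvariant (g : RiemMetric) : Prop :=
  ∀ (h : SO7) (m : M) (X Y : T m), g.inner (h • m) (push h m X) (push h m Y) = g.inner m X Y

/-- The volume density of `g` (the square root of the Gram determinant) takes the value one on
the frame `A, …, R'` and all its translates. -/
def RiemMetric.IsNormalised (g : RiemMetric) : Prop :=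
  ∀ a : SO7,
    Real.sqrt (Matrix.det (Matrix.of fun i j => g.inner (a : M) (frame a i) (frame a j))) = 1

/-- `I`, `J`, `K` satisfy the quaternion identities and `I`, `J` (hence `K`) are compatible with
the inner product `g`. -/
structure IsQuaternionicTriple {V : Type*} [AddCommGroup V] [Module ℝ V]
    (g : LinearMap.BilinForm ℝ V) (I J K : Module.End ℝ V) : Prop where
  I_sq : I * I = -1
  J_sq : J * J = -1
  I_mul_J : I * J = K
  J_mul_I : J * I = -K
  I_compat : ∀ X Y, g (I X) (I Y) = g X Y
  J_compat : ∀ X Y, g (J X) (J Y) = g X Y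

/-- An almost quaternion-Hermitian structure on `M`: a Riemannian metric `g` and a subbundle `G`
of `End(TM)` of rank three that locally has a smooth basis `I`, `J`, `K` satisfying the quaternion
identities and compatible with `g`. -/
@[ext] structure AQHStructure where
  g : RiemMetric
  G : ∀ m : M, Submodule ℝ (Module.End ℝ (T m))
  local_basis : ∀ m₀ : M, ∃ (U : Set M) (I J K : ∀ m : M, Module.End ℝ (T m)),
    IsOpen U ∧ m₀ ∈ U ∧ SmoothEndOn I U ∧ SmoothEndOn J U ∧ SmoothEndOn K U ∧
    ∀ m ∈ U, IsQuaternionicTriple (g.inner m) (I m) (J m) (K m) ∧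
      LinearIndependent ℝ ![I m, J m, K m] ∧ G m = Submodule.span ℝ {I m, J m, K m}

/-- Invariance under `SO(7)`: the metric is invariant, and conjugation by the differential of
the action of `h` maps the fibre of `G` at `m` onto the fibre at `hm`. -/
def AQHStructure.IsInvariant (Q : AQHStructure) : Prop :=
  Q.g.IsInvariant ∧
    ∀ (h : SO7) (m : M), (Q.G m).map (push h m).conj.toLinearMap = Q.G (h • m)

/-! ### The explicit forms

These are forms on `so(7)` that vanish on `u(3)`, built from the one-forms
`a = coM (0, ·)`, `a' = coM (1, ·)`, `p = coM (2, ·)`, `p' = coM (3, ·)`, with a sum over the cyclic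
permutations `(a, a', p, p') → (b, b', q, q') → (c, c', r, r')`. -/

/-- `(α ∧ β)(X, Y) = α(X)β(Y) - α(Y)β(X)`. -/
def wedgeForm (α β : Mat → ℝ) (X Y : Mat) : ℝ := α X * β Y - α Y * β X

/-- `𝔖 a' ∧ a` -/
def omega0 (X Y : Mat) : ℝ := ∑ k, wedgeForm (coM (1, k)) (coM (0, k)) X Y

/-- `𝔖 p' ∧ p` -/
def omega0' (X Y : Mat) : ℝ := ∑ k, wedgeForm (coM (3, k)) (coM (2, k)) X Y

/-- `ω_I = λω₀ + μω̃₀` -/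
def omegaI (lam mu : ℝ) (X Y : Mat) : ℝ := lam * omega0 X Y + mu * omega0' X Y

/-- The real part `𝔖 (p ∧ a - p' ∧ a')` of `𝔖 (p + ip') ∧ (a + ia')`. -/
def omegaJ (X Y : Mat) : ℝ :=
  ∑ k, (wedgeForm (coM (2, k)) (coM (0, k)) X Y - wedgeForm (coM (3, k)) (coM (1, k)) X Y)

/-- The imaginary part `𝔖 (p ∧ a' + p' ∧ a)` of `𝔖 (p + ip') ∧ (a + ia')`. -/
def omegaK (X Y : Mat) : ℝ :=
  ∑ k, (wedgeForm (coM (2, k)) (coM (1, k)) X Y + wedgeForm (coM (3, k)) (coM (0, k)) X Y)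

/-- `𝔖 (λ(a² + a'²) + μ(p² + p'²))` -/
def metricForm (lam mu : ℝ) (X Y : Mat) : ℝ :=
  ∑ k, (lam * (coM (0, k) X * coM (0, k) Y + coM (1, k) X * coM (1, k) Y) +
    mu * (coM (2, k) X * coM (2, k) Y + coM (3, k) X * coM (3, k) Y))

/-- `g = 𝔖 (λ(a² + a'²) + μ(p² + p'²))`: the metric is given at every point `aU(3)` by the
left-invariant form `metricForm lam mu` on `SO(7)`. -/
def RiemMetric.IsStandard (g : RiemMetric) (lam mu : ℝ) : Prop :=
  ∀ (a : SO7) (X Y : T (a : M)), g.inner a X Y = metricForm lam mu (Ad a⁻¹ X) (Ad a⁻¹ Y)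

/-- The almost quaternion-Hermitian structure is the one given by the left-invariant forms
`ω_I`, `ω_J`, `ω_K` and the metric `𝔖 (λ(a² + a'²) + μ(p² + p'²))`: for every lift `a` of a point
`m = aU(3)` of `M` (that is, for every value at `m` of a local section of `SO(7)/SU(3) → M`), the
fibre of `G` at `m` has the basis `I`, `J`, `K` determined by `ω_I = g(·, I·)`, `ω_J = g(·, J·)` and
`ω_K = g(·, K·)`, and this is a compatible quaternionic triple. -/
def AQHStructure.IsStandard (Q : AQHStructure) (lam mu : ℝ) : Prop :=
  Q.g.IsStandard lam mu ∧
    ∀ a : SO7, ∃ I J K : Module.End ℝ (T (a : M)),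
      (∀ X Y, Q.g.inner a X (I Y) = omegaI lam mu (Ad a⁻¹ X) (Ad a⁻¹ Y)) ∧
      (∀ X Y, Q.g.inner a X (J Y) = omegaJ (Ad a⁻¹ X) (Ad a⁻¹ Y)) ∧
      (∀ X Y, Q.g.inner a X (K Y) = omegaK (Ad a⁻¹ X) (Ad a⁻¹ Y)) ∧
      IsQuaternionicTriple (Q.g.inner a) I J K ∧ Q.G a = Submodule.span ℝ {I, J, K}

end TwistorS6

end

noncomputable section

namespace TwistorS6

open Matrix

/-! ### Coordinates on `𝔪` -/

/-! As a `U(3)`-module, 𝔪 is ℂ³ ⊕ Λ²ℂ³. If `h` acts on ℂ³ by the unitary matrix `H`, then (a + ia',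
…) is multiplied by `H`, and (p + ip', …) by the cofactor matrix of `H`, which is det H times the
conjugate of `H`. So the Hermitian forms of both summands are invariant, and with them g and ω_I
(`hermC_Ad`), while the pairing ω_J + iω_K of the summands is multiplied by det H (`omegaC_Ad`). A
change of lift thus fixes I and rotates the plane of J and K, so their span is well defined on `M`;
smooth local J and K arise from a phase that varies like det H (`fieldJ_mk`). Compatibility of J
with g forces λμ = 1, which is also the volume normalisation.

Conversely, the two summands are irreducible, and -1 in `U(3)` separates them, so an invariant
metric has just two parameters (`RiemMetric.IsInvariant.isStandard`).

For an invariant structure, the fibre at the base point is a real representation of `U(3)` of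
dimension three, on which SU(3) should act trivially. It suffices to know this for `elT` and `elS`,
and `mem_fixer_of_finrank` derives it from relations between a few group elements, without
continuity. Hence I, J, K commute with the isotropy action of these two elements. The commutant is
an algebra of 2 × 2 complex matrices with `matZ` as imaginary unit; its g-skew part is u(2), the sum
of the line of `matZ` and the standard span su(2) (`eq_of_skew_of_commute`). Each of I, J, K is half
the commutator of the other two, so it lies in [u(2), u(2)] = su(2). Equal dimensions give equality
at the base point (`AQHStructure.IsInvariant.base_eq`), and homogeneity gives it everywhere. -/

theorem coM_add (i : Fin 4 × Fin 3) (X Y : Mat) : coM i (X + Y) = coM i X + coM i Y := by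
  obtain ⟨i, k⟩ := i
  fin_cases i <;> fin_cases k <;> simp [coM] <;> ring

theorem coM_smul (i : Fin 4 × Fin 3) (c : ℝ) (X : Mat) : coM i (c • X) = c * coM i X := by
  obtain ⟨i, k⟩ := i
  fin_cases i <;> fin_cases k <;> simp [coM] <;> ring

/-- The one-form `coM i` as a linear map. -/
def coL (i : Fin 4 × Fin 3) : Mat →ₗ[ℝ] ℝ where
  toFun := coM i
  map_add' := coM_add i
  map_smul' := coM_smul i

@[simp] theorem coL_apply (i : Fin 4 × Fin 3) (X : Mat) : coL i X = coM i X := rfl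

theorem basisM_zero (k : Fin 3) : basisM (0, k) = wedge 0 (![1, 2, 3] k) := by
  fin_cases k <;> rfl

theorem basisM_one (k : Fin 3) : basisM (1, k) = wedge 0 (![4, 5, 6] k) := by
  fin_cases k <;> rfl

theorem basisM_two (k : Fin 3) : basisM (2, k) =
    wedge (![2, 3, 1] k) (![3, 1, 2] k) - wedge (![5, 6, 4] k) (![6, 4, 5] k) := by
  fin_cases k <;> rfl

theorem basisM_three (k : Fin 3) : basisM (3, k) =
    wedge (![2, 3, 1] k) (![6, 4, 5] k) - wedge (![3, 1, 2] k) (![5, 6, 4] k) := by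
  fin_cases k <;> rfl

theorem coM_zero (k : Fin 3) (X : Mat) : coM (0, k) X = X (![1, 2, 3] k) 0 := by
  fin_cases k <;> rfl

theorem coM_one (k : Fin 3) (X : Mat) : coM (1, k) X = X (![4, 5, 6] k) 0 := by
  fin_cases k <;> rfl

theorem coM_two (k : Fin 3) (X : Mat) : coM (2, k) X =
    (X (![3, 1, 2] k) (![2, 3, 1] k) - X (![6, 4, 5] k) (![5, 6, 4] k)) / 2 := by
  fin_cases k <;> rfl

theorem coM_three (k : Fin 3) (X : Mat) : coM (3, k) X =
    (X (![6, 4, 5] k) (![2, 3, 1] k) - X (![5, 6, 4] k) (![3, 1, 2] k)) / 2 := by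
  fin_cases k <;> rfl

theorem coM_basisM (i j : Fin 4 × Fin 3) : coM i (basisM j) = if i = j then 1 else 0 := by
  obtain ⟨i, k⟩ := i
  obtain ⟨j, l⟩ := j
  fin_cases i <;> fin_cases j <;>
    simp only [Fin.zero_eta, Fin.mk_one, Fin.reduceFinMk, coM_zero, coM_one, coM_two, coM_three,
      basisM_zero, basisM_one, basisM_two, basisM_three, Matrix.sub_apply, wedge_apply] <;>
    fin_cases k <;> fin_cases l <;> simp

/-! ### Elements of u(3) and the expansion of 𝔪 in its basis. -/

theorem mem_u3_of_apply {Y : Mat} (h : Yᵀ = -Y) (h0 : ∀ i, Y i 0 = 0)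
    (hE : ∀ i j, (Y * matE) i j = (matE * Y) i j) : Y ∈ u3 := by
  refine ⟨h, ?_, ?_⟩
  · ext i
    simp [h0]
  · ext i j
    exact hE i j

/-- With `real_mem_u3` and `imag_mem_u3` this exhausts the skew-Hermitian matrices: imaginary
diagonal, real skew part, imaginary symmetric part. -/
theorem diag_mem_u3 (c : Fin 3 → ℝ) :
    c 0 • wedge 1 4 + c 1 • wedge 2 5 + c 2 • wedge 3 6 ∈ u3 := by
  refine mem_u3_of_apply ?_ ?_ ?_
  · simp [Matrix.transpose_add, transpose_wedge]; abel
  · intro i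
    simp [wedge_apply]
  · intro i j
    simp only [matE, mul_add, add_mul, Matrix.add_apply, mul_wedge_apply, wedge_mul_apply,
      Matrix.smul_apply, wedge_apply]
    fin_cases i <;> fin_cases j <;> simp

theorem real_mem_u3 (c : Fin 3 → ℝ) :
    c 0 • (wedge 1 2 + wedge 4 5) + c 1 • (wedge 2 3 + wedge 5 6) +
      c 2 • (wedge 3 1 + wedge 6 4) ∈ u3 := by
  refine mem_u3_of_apply ?_ ?_ ?_
  · simp [Matrix.transpose_add, transpose_wedge]; abel
  · intro i
    simp [wedge_apply]
  · intro i j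
    simp only [matE, mul_add, add_mul, Matrix.add_apply, mul_wedge_apply, wedge_mul_apply,
      Matrix.smul_apply, wedge_apply]
    fin_cases i <;> fin_cases j <;> simp

theorem imag_mem_u3 (c : Fin 3 → ℝ) :
    c 0 • (wedge 1 5 + wedge 2 4) + c 1 • (wedge 2 6 + wedge 3 5) +
      c 2 • (wedge 3 4 + wedge 1 6) ∈ u3 := by
  refine mem_u3_of_apply ?_ ?_ ?_
  · simp [Matrix.transpose_add, transpose_wedge]; abel
  · intro i
    simp [wedge_apply]
  · intro i j
    simp only [matE, mul_add, add_mul, Matrix.add_apply, mul_wedge_apply, wedge_mul_apply,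
      Matrix.smul_apply, wedge_apply]
    fin_cases i <;> fin_cases j <;> simp

theorem mSpace_apply_comm {X : Mat} (hX : X ∈ mSpace) (i j : Fin 7) : X j i = -X i j :=
  congrFun (congrFun hX.1 i) j

/-- A skew matrix has 21 free entries. Orthogonality to the nine generators of u(3) leaves twelve,
which are exactly those that `coM` reads. -/
theorem eq_sum_coM {X : Mat} (hX : X ∈ mSpace) : X = ∑ i, coM i X • basisM i := by
  have hs := mSpace_apply_comm hX
  have d := fun c => hX.2 _ (diag_mem_u3 c)
  have r := fun c => hX.2 _ (real_mem_u3 c)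
  have m := fun c => hX.2 _ (imag_mem_u3 c)
  have tr : ∀ i j, (X * wedge i j).trace = X i j - X j i := fun i j => by
    rw [Matrix.trace_mul_comm, trace_wedge_mul]
  simp only [mul_add, Matrix.trace_add, Matrix.mul_smul, Matrix.trace_smul, tr,
    smul_eq_mul] at d r m
  have d0 := d ![1, 0, 0]
  have d1 := d ![0, 1, 0]
  have d2 := d ![0, 0, 1]
  have r0 := r ![1, 0, 0]
  have r1 := r ![0, 1, 0]
  have r2 := r ![0, 0, 1]
  have m0 := m ![1, 0, 0]
  have m1 := m ![0, 1, 0]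
  have m2 := m ![0, 0, 1]
  simp at d0 d1 d2 r0 r1 r2 m0 m1 m2
  have hd : ∀ i, X i i = 0 := fun i => by linarith [hs i i]
  have c65 : X 6 5 = -X 3 2 := by linarith [hs 2 3, hs 5 6]
  have c46 : X 4 6 = -X 1 3 := by linarith [hs 3 1, hs 6 4]
  have c54 : X 5 4 = -X 2 1 := by linarith [hs 1 2, hs 4 5]
  have c53 : X 5 3 = -X 6 2 := by linarith [hs 2 6, hs 3 5]
  have c61 : X 6 1 = -X 4 3 := by linarith [hs 3 4, hs 1 6]
  have c42 : X 4 2 = -X 5 1 := by linarith [hs 1 5, hs 2 4]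
  have c41 : X 4 1 = 0 := by linarith [hs 1 4]
  have c52 : X 5 2 = 0 := by linarith [hs 2 5]
  have c63 : X 6 3 = 0 := by linarith [hs 3 6]
  clear d r m d0 d1 d2 r0 r1 r2 m0 m1 m2
  ext i j
  simp only [Fintype.sum_prod_type, Fin.sum_univ_four, Fin.sum_univ_three, coM_zero, coM_one,
    coM_two, coM_three, basisM_zero, basisM_one, basisM_two, basisM_three, Matrix.add_apply,
    Matrix.smul_apply, Matrix.sub_apply, wedge_apply]
  fin_cases i <;> fin_cases j <;>
    simp [hd, c65, c46, c54, c53,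
      c61, c42, c41, c52, c63, hs 1 0, hs 2 0, hs 3 0, hs 4 0, hs 5 0, hs 6 0, hs 3 2, hs 1 3,
      hs 2 1, hs 6 2, hs 4 3, hs 5 1, hs 6 5, hs 4 6, hs 5 4, hs 5 3, hs 6 1, hs 4 2, hs 4 1,
      hs 5 2, hs 6 3]

theorem mSpace_ext {X Y : Mat} (hX : X ∈ mSpace) (hY : Y ∈ mSpace) (h : ∀ i, coM i X = coM i Y) :
    X = Y := by
  rw [eq_sum_coM hX, eq_sum_coM hY]
  simp only [h]

theorem Ad_inv_mem_mSpace {a : SO7} {X : Mat} (hX : X ∈ T (a : M)) : Ad a⁻¹ X ∈ mSpace :=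
  hX a rfl

/-- The frame `A, …, R'` at `aU(3)` as a basis. -/
def frameBasis (a : SO7) : Module.Basis (Fin 4 × Fin 3) ℝ (T (a : M)) :=
  Module.Basis.ofEquivFun
    { toFun := fun X i => coM i (Ad a⁻¹ X)
      invFun := fun c => ∑ i, c i • frame a i
      map_add' := fun X Y => by ext i; simp [coM_add]
      map_smul' := fun c X => by ext i; simp [coM_smul]
      left_inv := fun X => by
        apply Subtype.ext
        have := eq_sum_coM (Ad_inv_mem_mSpace X.2)
        conv_rhs => rw [← Ad_self_inv a (X : Mat), this]
        simp [frame]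
      right_inv := fun c => by
        ext i
        simp only [← coL_apply, Submodule.coe_sum, Submodule.coe_smul, map_sum, map_smul, frame,
          Ad_inv_self]
        simp [coM_basisM] }

theorem frameBasis_repr (a : SO7) (X : T (a : M)) (i : Fin 4 × Fin 3) :
    (frameBasis a).repr X i = coM i (Ad a⁻¹ X) := rfl

@[simp] theorem frameBasis_apply (a : SO7) (i : Fin 4 × Fin 3) : frameBasis a i = frame a i := by
  apply (frameBasis a).repr.injective
  rw [Module.Basis.repr_self]
  ext j
  rw [frameBasis_repr, frame, Ad_inv_self, coM_basisM, Finsupp.single_apply]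
  simp only [eq_comm]

theorem tangent_ext {a : SO7} {X Y : T (a : M)}
    (h : ∀ i, coM i (Ad a⁻¹ (X : Mat)) = coM i (Ad a⁻¹ (Y : Mat))) : X = Y :=
  (frameBasis a).ext_elem h

/-! ### The invariant forms in coordinates -/

/-- The coefficients of the metric: `λ` on `A, …, C'` and `μ` on `P, …, R'`. -/
def wt (lam mu : ℝ) : Fin 4 → ℝ := ![lam, lam, mu, mu]

theorem metricForm_eq (lam mu : ℝ) (X Y : Mat) :
    metricForm lam mu X Y = ∑ i, wt lam mu i.1 * (coM i X * coM i Y) := by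
  simp only [metricForm, Fintype.sum_prod_type, Fin.sum_univ_four, Fin.sum_univ_three, wt]
  simp
  ring

theorem metricForm_basisM_left (lam mu : ℝ) (i : Fin 4 × Fin 3) (Y : Mat) :
    metricForm lam mu (basisM i) Y = wt lam mu i.1 * coM i Y := by
  simp [metricForm_eq, coM_basisM]

theorem metricForm_comm (lam mu : ℝ) (X Y : Mat) :
    metricForm lam mu X Y = metricForm lam mu Y X := by
  simp only [metricForm_eq, mul_comm]

/-- The metric form as a bilinear form. -/
def metricBilin (lam mu : ℝ) : LinearMap.BilinForm ℝ Mat :=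
  LinearMap.mk₂ ℝ (metricForm lam mu)
    (fun X Y Z => by
      simp only [metricForm_eq, coM_add, ← Finset.sum_add_distrib]
      exact Finset.sum_congr rfl fun i _ => by ring)
    (fun c X Y => by
      simp only [metricForm_eq, coM_smul, smul_eq_mul, Finset.mul_sum]
      exact Finset.sum_congr rfl fun i _ => by ring)
    (fun X Y Z => by
      simp only [metricForm_eq, coM_add, ← Finset.sum_add_distrib]
      exact Finset.sum_congr rfl fun i _ => by ring)
    (fun c X Y => by
      simp only [metricForm_eq, coM_smul, smul_eq_mul, Finset.mul_sum]
      exact Finset.sum_congr rfl fun i _ => by ring)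

@[simp] theorem metricBilin_apply (lam mu : ℝ) (X Y : Mat) :
    metricBilin lam mu X Y = metricForm lam mu X Y := rfl

theorem wt_pos {lam mu : ℝ} (hl : 0 < lam) (hm : 0 < mu) (i : Fin 4) : 0 < wt lam mu i := by
  fin_cases i <;> simpa [wt]

theorem metricForm_pos {lam mu : ℝ} (hl : 0 < lam) (hm : 0 < mu) {X : Mat} (hX : X ∈ mSpace)
    (h0 : X ≠ 0) : 0 < metricForm lam mu X X := by
  rw [metricForm_eq]
  obtain ⟨i, hi⟩ : ∃ i, coM i X ≠ 0 := by
    by_contra! h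
    exact h0 (mSpace_ext hX mSpace.zero_mem fun i => by
      rw [h i, ← coL_apply, map_zero])
  exact Finset.sum_pos' (fun j _ => mul_nonneg (wt_pos hl hm _).le (mul_self_nonneg _))
    ⟨i, Finset.mem_univ _, mul_pos (wt_pos hl hm _) (mul_self_pos.2 hi)⟩

theorem metricForm_ext {lam mu : ℝ} (hl : 0 < lam) (hm : 0 < mu) {X Y : Mat} (hX : X ∈ mSpace)
    (hY : Y ∈ mSpace) (h : ∀ Z ∈ mSpace, metricForm lam mu Z X = metricForm lam mu Z Y) :
    X = Y :=
  mSpace_ext hX hY fun i => by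
    have := h _ (basisM_mem i)
    rw [metricForm_basisM_left, metricForm_basisM_left] at this
    exact mul_left_cancel₀ (wt_pos hl hm _).ne' this

/-! ### Complex coordinates -/

/-- The matrix of `ℝ⁷ → ℂ³`, `(x₀, x, x') ↦ x + ix'`. -/
def cplx : Matrix (Fin 3) (Fin 7) ℂ :=
  !![0, 1, 0, 0, Complex.I, 0, 0; 0, 0, 1, 0, 0, Complex.I, 0; 0, 0, 0, 1, 0, 0, Complex.I]

/-- A real matrix as a complex matrix. -/
abbrev toC (X : Mat) : Matrix (Fin 7) (Fin 7) ℂ := X.map Complex.ofRealHom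

theorem toC_mul (X Y : Mat) : toC (X * Y) = toC X * toC Y := Matrix.map_mul

theorem toC_transpose (X : Mat) : toC Xᵀ = (toC X)ᵀ := rfl

theorem conjTranspose_toC (X : Mat) : (toC X)ᴴ = (toC X)ᵀ := by
  ext i j
  simp [toC]

/-- The complex linear part on `ℂ³` of an endomorphism of `ℝ⁷`. -/
def linPart (X : Mat) : Matrix (Fin 3) (Fin 3) ℂ := (1 / 2 : ℂ) • (cplx * toC X * cplxᴴ)

theorem cplx_mul_conjTranspose : cplx * cplxᴴ = (2 : ℂ) • (1 : Matrix (Fin 3) (Fin 3) ℂ) := by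
  ext i j
  fin_cases i <;> fin_cases j <;>
    simp [cplx, Matrix.mul_apply, Fin.sum_univ_succ] <;> norm_num

theorem matE_sq_apply (i j : Fin 7) : (matE * matE) i j = if i = j ∧ i ≠ 0 then -1 else 0 := by
  simp only [matE, mul_add, Matrix.add_apply, mul_wedge_apply, wedge_apply]
  fin_cases i <;> fin_cases j <;> simp

theorem matE_apply (i j : Fin 7) : matE i j =
    !![0, 0, 0, 0, 0, 0, 0; 0, 0, 0, 0, -1, 0, 0; 0, 0, 0, 0, 0, -1, 0; 0, 0, 0, 0, 0, 0, -1;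
      0, 1, 0, 0, 0, 0, 0; 0, 0, 1, 0, 0, 0, 0; 0, 0, 0, 1, 0, 0, 0] i j := by
  simp only [matE, Matrix.add_apply, wedge_apply]
  fin_cases i <;> fin_cases j <;> simp

/-- This is twice the projection onto the i-eigenspace of `matE`. Being a polynomial in `matE`, it
commutes with `U(3)`. -/
theorem conjTranspose_mul_cplx :
    cplxᴴ * cplx = -toC (matE * matE) - Complex.I • toC matE := by
  ext i j
  simp only [Matrix.sub_apply, Matrix.neg_apply, Matrix.smul_apply, toC, Matrix.map_apply,
    matE_sq_apply, matE_apply]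
  fin_cases i <;> fin_cases j <;>
    simp [cplx, Matrix.mul_apply, Fin.sum_univ_succ]

theorem toC_mul_matE {h : SO7} (hh : h ∈ U3) :
    toC h * (cplxᴴ * cplx) = cplxᴴ * cplx * toC h := by
  have e : toC h * toC matE = toC matE * toC h := by rw [← toC_mul, ← toC_mul, hh.2]
  rw [conjTranspose_mul_cplx, mul_sub, sub_mul, mul_neg, neg_mul, mul_smul_comm, smul_mul_assoc, e,
    toC_mul, ← mul_assoc, e, mul_assoc, e, ← mul_assoc]

theorem cplx_mul_toC {h : SO7} (hh : h ∈ U3) : cplx * toC h = linPart h * cplx := by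
  have h2 : cplx * (toC h * (cplxᴴ * cplx)) = (2 : ℂ) • (cplx * toC h) := by
    rw [toC_mul_matE hh, ← Matrix.mul_assoc, ← Matrix.mul_assoc, cplx_mul_conjTranspose,
      Matrix.smul_mul, Matrix.one_mul, Matrix.smul_mul]
  rw [linPart, Matrix.smul_mul, Matrix.mul_assoc, Matrix.mul_assoc, h2, smul_smul]
  norm_num

theorem coe_inv (h : SO7) : ((h⁻¹ : SO7) : Mat) = (h : Mat)ᵀ := rfl

theorem coe_mul_coe_inv (h : SO7) : (h : Mat) * ((h⁻¹ : SO7) : Mat) = 1 := by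
  rw [← Submonoid.coe_mul, mul_inv_cancel, Submonoid.coe_one]

theorem linPart_inv (h : SO7) : linPart ((h⁻¹ : SO7) : Mat) = (linPart h)ᴴ := by
  rw [linPart, linPart, conjTranspose_smul, conjTranspose_mul, conjTranspose_mul,
    conjTranspose_conjTranspose, conjTranspose_toC, coe_inv, toC_transpose, Matrix.mul_assoc]
  simp

theorem toC_mul_conjTranspose {h : SO7} (hh : h ∈ U3) : toC h * cplxᴴ = cplxᴴ * linPart h := by
  have := congrArg conjTranspose (cplx_mul_toC (U3.inv_mem hh))
  rwa [conjTranspose_mul, conjTranspose_mul, linPart_inv, conjTranspose_conjTranspose,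
    conjTranspose_toC, coe_inv, toC_transpose, transpose_transpose] at this

/-- Only the right factor has to be complex linear. The freedom in `X` makes `cdet` usable away from
`U(3)`, as `phase` requires. -/
theorem linPart_mul (X : Mat) {h : SO7} (hh : h ∈ U3) :
    linPart (X * h) = linPart X * linPart h := by
  conv_lhs => rw [linPart]
  rw [toC_mul, Matrix.mul_assoc, Matrix.mul_assoc, toC_mul_conjTranspose hh]
  simp only [linPart, Matrix.smul_mul, Matrix.mul_assoc]

theorem linPart_one : linPart 1 = 1 := by
  have : toC (1 : Mat) = 1 := by simp [toC]
  rw [linPart, this, Matrix.mul_one, cplx_mul_conjTranspose, smul_smul]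
  norm_num

theorem linPart_mul_conjTranspose {h : SO7} (hh : h ∈ U3) :
    linPart h * (linPart h)ᴴ = 1 := by
  rw [← linPart_inv, ← linPart_mul _ (U3.inv_mem hh), coe_mul_coe_inv, linPart_one]

/-- The complex determinant of the complex linear part. -/
def cdet (X : Mat) : ℂ := (linPart X).det

theorem cdet_mul (X : Mat) {h : SO7} (hh : h ∈ U3) : cdet (X * h) = cdet X * cdet h := by
  rw [cdet, linPart_mul X hh, det_mul, cdet, cdet]

theorem cdet_one : cdet 1 = 1 := by rw [cdet, linPart_one, det_one]

theorem cdet_inv (h : SO7) : cdet ((h⁻¹ : SO7) : Mat) = star (cdet h) := by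
  rw [cdet, linPart_inv, det_conjTranspose, cdet]

theorem cdet_mul_star {h : SO7} (hh : h ∈ U3) : cdet h * star (cdet h) = 1 := by
  rw [cdet, ← det_conjTranspose, ← det_mul, linPart_mul_conjTranspose hh, det_one]

/-- The vector `(a + ia', b + ib', c + ic')`. -/
def alphaV (X : Mat) : Fin 3 → ℂ := fun k => coM (0, k) X + coM (1, k) X * Complex.I

/-- The vector `(p + ip', q + iq', r + ir')`. -/
def piV (X : Mat) : Fin 3 → ℂ := fun k => coM (2, k) X + coM (3, k) X * Complex.I

/-- The complex skew matrix with axial vector `v`. -/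
def axial (v : Fin 3 → ℂ) : Matrix (Fin 3) (Fin 3) ℂ :=
  !![0, -v 2, v 1; v 2, 0, -v 0; -v 1, v 0, 0]

theorem axial_injective : Function.Injective axial := by
  intro v w h
  ext k
  fin_cases k
  · simpa [axial] using congrFun (congrFun h 2) 1
  · simpa [axial] using congrFun (congrFun h 0) 2
  · simpa [axial] using congrFun (congrFun h 1) 0

/-- The action of `H` on Λ²ℂ³, modelled by skew matrices, becomes the cofactor matrix on axial
vectors. This is a polynomial identity and holds for every `H`. -/
theorem mul_axial_mul (H : Matrix (Fin 3) (Fin 3) ℂ) (v : Fin 3 → ℂ) :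
    H * axial v * Hᵀ = axial (H.adjugateᵀ *ᵥ v) := by
  ext i j
  fin_cases i <;> fin_cases j <;>
    simp [axial, Matrix.mul_apply, Fin.sum_univ_three, adjugate_fin_three, mulVec, dotProduct] <;>
    ring

theorem cplx_mul_apply {n : Type*} (Y : Matrix (Fin 7) n ℂ) (k : Fin 3) (j : n) :
    (cplx * Y) k j = Y (![1, 2, 3] k) j + Complex.I * Y (![4, 5, 6] k) j := by
  rw [Matrix.mul_apply]
  fin_cases k <;> simp [cplx, Fin.sum_univ_succ]

theorem mul_transpose_cplx_apply {n : Type*} (Y : Matrix n (Fin 7) ℂ) (j : n) (k : Fin 3) :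
    (Y * cplxᵀ) j k = Y j (![1, 2, 3] k) + Complex.I * Y j (![4, 5, 6] k) := by
  rw [← transpose_apply (Y * cplxᵀ), transpose_mul, transpose_transpose, cplx_mul_apply]
  rfl

theorem cplx_mulVec (X : Mat) : (cplx * toC X) *ᵥ Pi.single 0 1 = alphaV X := by
  ext k
  rw [mulVec_single_one]
  simp only [alphaV, coM_zero, coM_one, Matrix.col_apply, cplx_mul_apply, Matrix.map_apply,
    mul_comm]
  rfl

/-- The left side sees only the antilinear part of `X`, because `cplx * cplxᵀ = 0`. Skewness of `X`
makes it a skew 3 × 3 matrix, hence a vector of ℂ³. -/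
theorem cplx_mul_mul_transpose {X : Mat} (hX : Xᵀ = -X) :
    cplx * toC X * cplxᵀ = (2 : ℂ) • axial (piV X) := by
  have hs : ∀ i j, X j i = -X i j := fun i j => congrFun (congrFun hX i) j
  have hd : ∀ i, X i i = 0 := fun i => by linarith [hs i i]
  have hI : Complex.I ^ 2 = -1 := Complex.I_sq
  ext k l
  simp only [mul_transpose_cplx_apply, cplx_mul_apply, Matrix.map_apply, Matrix.smul_apply, piV,
    coM_two, coM_three, axial]
  fin_cases k <;> fin_cases l <;>
    simp [hd, hs 2 1, hs 3 1, hs 4 1, hs 5 1, hs 6 1, hs 3 2, hs 4 2, hs 5 2, hs 6 2, hs 4 3,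
      hs 5 3, hs 6 3, hs 5 4, hs 6 4, hs 6 5]
  all_goals first
    | ring1
    | linear_combination (X 5 4 : ℂ) * hI
    | linear_combination (X 6 4 : ℂ) * hI
    | linear_combination (X 6 5 : ℂ) * hI
    | linear_combination -(X 5 4 : ℂ) * hI
    | linear_combination -(X 6 4 : ℂ) * hI
    | linear_combination -(X 6 5 : ℂ) * hI

theorem toC_Ad (h : SO7) (X : Mat) : toC (Ad h X) = toC h * toC X * (toC h)ᵀ := by
  change toC ((h : Mat) * X * ((h⁻¹ : SO7) : Mat)) = _
  rw [toC_mul, toC_mul, coe_inv, toC_transpose]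

theorem alphaV_Ad {h : SO7} (hh : h ∈ U3) (X : Mat) :
    alphaV (Ad h X) = linPart h *ᵥ alphaV X := by
  -- `hᵀ` is the inverse of `h`, so it fixes the basis vector 0 as well.
  have h0 : (toC h)ᵀ *ᵥ Pi.single 0 1 = Pi.single 0 1 := by
    ext i
    have := congrFun (U3.inv_mem hh).1 i
    rw [coe_inv, mulVec_single_one] at this
    rw [mulVec_single_one]
    change ((h : Mat) 0 i : ℂ) = _
    change (h : Mat) 0 i = _ at this
    rw [this, Pi.single_apply, Pi.single_apply]
    split_ifs <;> simp
  rw [← cplx_mulVec, toC_Ad, ← Matrix.mul_assoc, ← mulVec_mulVec, h0, ← Matrix.mul_assoc,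
    cplx_mul_toC hh, Matrix.mul_assoc, ← mulVec_mulVec, cplx_mulVec]

theorem adjugate_linPart {h : SO7} (hh : h ∈ U3) :
    (linPart h).adjugate = cdet h • (linPart h)ᴴ := by
  rw [← Matrix.mul_one (linPart h).adjugate, ← linPart_mul_conjTranspose hh, ← Matrix.mul_assoc,
    adjugate_mul, Matrix.smul_mul, Matrix.one_mul, cdet]

theorem piV_Ad {h : SO7} (hh : h ∈ U3) {X : Mat} (hX : Xᵀ = -X) :
    piV (Ad h X) = (linPart h).adjugateᵀ *ᵥ piV X := by
  apply axial_injective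
  have h2 : (2 : ℂ) ≠ 0 := two_ne_zero
  apply smul_right_injective _ h2
  have hA : (Ad h X)ᵀ = -Ad h X := by rw [transpose_Ad, hX, map_neg]
  change (2 : ℂ) • axial _ = (2 : ℂ) • axial _
  rw [← cplx_mul_mul_transpose hA, ← mul_axial_mul, toC_Ad, ← Matrix.smul_mul, ← Matrix.mul_smul,
    ← cplx_mul_mul_transpose hX]
  have e := cplx_mul_toC hh
  have e' : (toC h)ᵀ * cplxᵀ = cplxᵀ * (linPart h)ᵀ := by
    rw [← transpose_mul, e, transpose_mul]
  simp only [Matrix.mul_assoc]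
  rw [e']
  simp only [← Matrix.mul_assoc]
  rw [e]

/-- The form `ω_J + iω_K = 𝔖 (p + ip') ∧ (a + ia')`. -/
def omegaC (X Y : Mat) : ℂ := piV X ⬝ᵥ alphaV Y - piV Y ⬝ᵥ alphaV X

theorem omegaC_eq (X Y : Mat) : omegaC X Y = omegaJ X Y + omegaK X Y * Complex.I := by
  apply Complex.ext <;>
    simp [omegaC, omegaJ, omegaK, wedgeForm, piV, alphaV, dotProduct, Fin.sum_univ_three] <;> ring

theorem omegaC_Ad {h : SO7} (hh : h ∈ U3) {X Y : Mat} (hX : X ∈ mSpace) (hY : Y ∈ mSpace) :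
    omegaC (Ad h X) (Ad h Y) = cdet h * omegaC X Y := by
  -- The adjugate moves to the other factor, where it meets `H` and leaves det H.
  have key : ∀ v w : Fin 3 → ℂ, ((linPart h).adjugateᵀ *ᵥ v) ⬝ᵥ (linPart h *ᵥ w) =
      cdet h * (v ⬝ᵥ w) := fun v w => by
    rw [dotProduct_mulVec, mulVec_transpose, vecMul_vecMul, adjugate_mul, vecMul_smul, vecMul_one,
      smul_dotProduct, smul_eq_mul, cdet]
  rw [omegaC, alphaV_Ad hh, alphaV_Ad hh, piV_Ad hh hX.1, piV_Ad hh hY.1, key, key, omegaC, mul_sub]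

/-- The Hermitian form with real part `metricForm` and imaginary part `-omegaI`. -/
def hermC (lam mu : ℝ) (X Y : Mat) : ℂ :=
  lam * (star (alphaV X) ⬝ᵥ alphaV Y) + mu * (star (piV X) ⬝ᵥ piV Y)

theorem hermC_eq (lam mu : ℝ) (X Y : Mat) :
    hermC lam mu X Y = metricForm lam mu X Y - omegaI lam mu X Y * Complex.I := by
  apply Complex.ext <;>
    simp [hermC, metricForm, omegaI, omega0, omega0', wedgeForm, piV, alphaV, dotProduct,
      Fin.sum_univ_three] <;> ring

theorem hermC_Ad (lam mu : ℝ) {h : SO7} (hh : h ∈ U3) {X Y : Mat} (hX : X ∈ mSpace)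
    (hY : Y ∈ mSpace) : hermC lam mu (Ad h X) (Ad h Y) = hermC lam mu X Y := by
  have hu : (linPart h)ᴴ * linPart h = 1 := mul_eq_one_comm.1 (linPart_mul_conjTranspose hh)
  have key : ∀ v w : Fin 3 → ℂ, star (linPart h *ᵥ v) ⬝ᵥ (linPart h *ᵥ w) = star v ⬝ᵥ w :=
    fun v w => by
      rw [star_mulVec, dotProduct_mulVec, vecMul_vecMul, hu, vecMul_one]
  -- The cofactor matrix is det H times the conjugate of `H`, so it is unitary too.
  have key' : ∀ v w : Fin 3 → ℂ, star ((linPart h).adjugateᵀ *ᵥ v) ⬝ᵥ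
      ((linPart h).adjugateᵀ *ᵥ w) = star v ⬝ᵥ w := fun v w => by
    have hu' : ((linPart h).adjugateᵀ)ᴴ * (linPart h).adjugateᵀ = 1 := by
      have e : ((linPart h)ᴴᵀ)ᴴ = (linPart h)ᵀ := by
        ext i j
        simp
      rw [adjugate_linPart hh, transpose_smul, conjTranspose_smul, Matrix.smul_mul, Matrix.mul_smul,
        e, ← transpose_mul, hu, transpose_one, smul_smul, mul_comm, cdet_mul_star hh, one_smul]
    rw [star_mulVec, dotProduct_mulVec, vecMul_vecMul, hu', vecMul_one]
  rw [hermC, alphaV_Ad hh, alphaV_Ad hh, piV_Ad hh hX.1, piV_Ad hh hY.1, key, key', hermC]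

theorem metricForm_Ad (lam mu : ℝ) {h : SO7} (hh : h ∈ U3) {X Y : Mat} (hX : X ∈ mSpace)
    (hY : Y ∈ mSpace) : metricForm lam mu (Ad h X) (Ad h Y) = metricForm lam mu X Y := by
  simpa [hermC_eq] using congrArg Complex.re (hermC_Ad lam mu hh hX hY)

theorem omegaI_Ad (lam mu : ℝ) {h : SO7} (hh : h ∈ U3) {X Y : Mat} (hX : X ∈ mSpace)
    (hY : Y ∈ mSpace) : omegaI lam mu (Ad h X) (Ad h Y) = omegaI lam mu X Y := by
  simpa [hermC_eq] using congrArg Complex.im (hermC_Ad lam mu hh hX hY)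

/-! ### Endomorphisms `L ⊗ 1` in the standard frames -/

/-- The endomorphism whose matrix in the frame at `a` is `L ⊗ 1`, where `L` acts on the four
families `A, B, C`; `A', B', C'`; `P, Q, R`; `P', Q', R'`. -/
def stdOp (L : Matrix (Fin 4) (Fin 4) ℝ) (a : SO7) : Mat →ₗ[ℝ] Mat :=
  ∑ i : Fin 4 × Fin 3, ((∑ j, L i.1 j • coL (j, i.2)) ∘ₗ Ad a⁻¹).smulRight (Ad a (basisM i))

theorem stdOp_apply (L : Matrix (Fin 4) (Fin 4) ℝ) (a : SO7) (X : Mat) :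
    stdOp L a X =
      ∑ i : Fin 4 × Fin 3, (∑ j, L i.1 j * coM (j, i.2) (Ad a⁻¹ X)) • Ad a (basisM i) := by
  simp [stdOp]

theorem stdOp_mem (L : Matrix (Fin 4) (Fin 4) ℝ) (a : SO7) (X : Mat) : stdOp L a X ∈ T (a : M) := by
  rw [stdOp_apply]
  exact Submodule.sum_mem _ fun i _ => Submodule.smul_mem _ _ (Ad_mem_tangent a (basisM_mem i))

theorem Ad_inv_stdOp (L : Matrix (Fin 4) (Fin 4) ℝ) (a : SO7) (X : Mat) :
    Ad a⁻¹ (stdOp L a X) =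
      ∑ i : Fin 4 × Fin 3, (∑ j, L i.1 j * coM (j, i.2) (Ad a⁻¹ X)) • basisM i := by
  simp only [stdOp_apply, map_sum, map_smul, Ad_inv_self]

theorem coM_stdOp (L : Matrix (Fin 4) (Fin 4) ℝ) (a : SO7) (X : Mat) (i : Fin 4 × Fin 3) :
    coM i (Ad a⁻¹ (stdOp L a X)) = ∑ j, L i.1 j * coM (j, i.2) (Ad a⁻¹ X) := by
  rw [Ad_inv_stdOp, ← coL_apply, map_sum]
  simp [coM_basisM]

theorem stdOp_mul_left (L : Matrix (Fin 4) (Fin 4) ℝ) (a b : SO7) (X : Mat) :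
    stdOp L (a * b) X = Ad a (stdOp L b (Ad a⁻¹ X)) := by
  simp only [stdOp_apply, _root_.mul_inv_rev, Ad_mul, map_sum, map_smul]

/-- The homomorphism `L ↦ L ⊗ 1` into the endomorphisms of the tangent space at `m = aU(3)`. -/
def endAt {m : M} (a : SO7) (h : (a : M) = m) :
    Matrix (Fin 4) (Fin 4) ℝ →ₐ[ℝ] Module.End ℝ (T m) :=
  AlgHom.ofLinearMap
    { toFun := fun L => (stdOp L a).restrict (p := T m) (q := T m) fun X _ => h ▸ stdOp_mem L a X
      map_add' := fun L L' => by
        ext X : 2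
        simp [LinearMap.restrict_apply, stdOp_apply, add_mul, Finset.sum_add_distrib, add_smul]
      map_smul' := fun c L => by
        ext X : 2
        simp [LinearMap.restrict_apply, stdOp_apply, mul_assoc, ← Finset.mul_sum,
          Finset.smul_sum, smul_smul] }
    (by
      subst h
      ext X : 1
      apply tangent_ext
      intro i
      simp [LinearMap.restrict_apply, coM_stdOp, Matrix.one_apply])
    (by
      subst h
      intro L L'
      ext X : 1
      apply tangent_ext
      intro i
      simp only [LinearMap.coe_mk, AddHom.coe_mk, LinearMap.restrict_apply, coM_stdOp,
        Module.End.mul_apply, Matrix.mul_apply, Finset.sum_mul, Finset.mul_sum]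
      rw [Finset.sum_comm]
      simp only [mul_assoc])

theorem coe_endAt {m : M} (a : SO7) (h : (a : M) = m) (L : Matrix (Fin 4) (Fin 4) ℝ) (X : T m) :
    ((endAt a h L X : T m) : Mat) = stdOp L a X := rfl

/-- The matrix of `I`. -/
def matI : Matrix (Fin 4) (Fin 4) ℝ := !![0, -1, 0, 0; 1, 0, 0, 0; 0, 0, 0, -1; 0, 0, 1, 0]

/-- The matrix of `x J - y K` for `z = x + iy`. -/
def matJ (lam mu : ℝ) (z : ℂ) : Matrix (Fin 4) (Fin 4) ℝ :=
  !![0, 0, -mu * z.re, mu * z.im; 0, 0, mu * z.im, mu * z.re;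
    lam * z.re, -lam * z.im, 0, 0; -lam * z.im, -lam * z.re, 0, 0]

theorem matJ_add (lam mu : ℝ) (z w : ℂ) : matJ lam mu (z + w) = matJ lam mu z + matJ lam mu w := by
  ext i j
  fin_cases i <;> fin_cases j <;> simp [matJ] <;> ring

theorem matJ_smul (lam mu c : ℝ) (z : ℂ) : matJ lam mu (c * z) = c • matJ lam mu z := by
  ext i j
  fin_cases i <;> fin_cases j <;> simp [matJ] <;> ring

theorem matI_sq : matI * matI = -1 := by
  ext i j
  fin_cases i <;> fin_cases j <;> simp [matI, Matrix.mul_apply, Fin.sum_univ_four]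

/-- In quaternions, I(xJ - yK) = yJ + xK, which is the rotation of z = x + iy to -iz. -/
theorem matI_mul_matJ (lam mu : ℝ) (z : ℂ) :
    matI * matJ lam mu z = matJ lam mu (-Complex.I * z) := by
  ext i j
  fin_cases i <;> fin_cases j <;> simp [matI, matJ, Matrix.mul_apply, Fin.sum_univ_four]

theorem matJ_mul_matI (lam mu : ℝ) (z : ℂ) :
    matJ lam mu z * matI = -matJ lam mu (-Complex.I * z) := by
  ext i j
  fin_cases i <;> fin_cases j <;> simp [matI, matJ, Matrix.mul_apply, Fin.sum_univ_four]

theorem matJ_sq {lam mu : ℝ} (hlm : lam * mu = 1) {z : ℂ} (hz : z * star z = 1) :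
    matJ lam mu z * matJ lam mu z = -1 := by
  have h : z.re * z.re + z.im * z.im = 1 := by
    have := congrArg Complex.re hz
    simpa using this
  ext i j
  fin_cases i <;> fin_cases j <;>
    simp [matJ, Matrix.mul_apply, Fin.sum_univ_four]
  all_goals first
    | ring1
    | linear_combination (-(z.re * z.re + z.im * z.im)) * hlm - h

theorem metricForm_stdOp (lam mu : ℝ) (L : Matrix (Fin 4) (Fin 4) ℝ) (a : SO7) (X Y : Mat) :
    metricForm lam mu Y (Ad a⁻¹ (stdOp L a X)) =
      ∑ i : Fin 4 × Fin 3,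
        wt lam mu i.1 * (coM i Y * ∑ j, L i.1 j * coM (j, i.2) (Ad a⁻¹ X)) := by
  simp only [metricForm_eq, coM_stdOp]

theorem metricForm_matI (lam mu : ℝ) (a : SO7) (X Y : Mat) :
    metricForm lam mu Y (Ad a⁻¹ (stdOp matI a X)) = omegaI lam mu Y (Ad a⁻¹ X) := by
  rw [metricForm_stdOp]
  simp [Fintype.sum_prod_type, Fin.sum_univ_four, Fin.sum_univ_three, wt, matI, omegaI, omega0,
    omega0', wedgeForm]
  ring

theorem metricForm_matJ {lam mu : ℝ} (hlm : lam * mu = 1) (z : ℂ) (a : SO7) (X Y : Mat) :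
    metricForm lam mu Y (Ad a⁻¹ (stdOp (matJ lam mu z) a X)) =
      (z * omegaC Y (Ad a⁻¹ X)).re := by
  rw [metricForm_stdOp, omegaC_eq]
  generalize Ad a⁻¹ X = W
  -- The factor `lam * mu = 1` is inserted so that both sides agree as polynomials.
  have e : (z * (omegaJ Y W + omegaK Y W * Complex.I)).re =
      lam * mu * (z.re * omegaJ Y W - z.im * omegaK Y W) := by
    rw [hlm]
    simp
  rw [e]
  simp [Fintype.sum_prod_type, Fin.sum_univ_four, Fin.sum_univ_three, wt, matJ, omegaJ, omegaK,
    wedgeForm]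
  ring

theorem Ad_injective (a : SO7) : Function.Injective (Ad a) := fun X Y h => by
  rw [← Ad_inv_self a X, h, Ad_inv_self]

theorem mul_mk_eq {a h : SO7} (hh : h ∈ U3) : ((a * h : SO7) : M) = a :=
  (QuotientGroup.eq.2 (by simpa using hh)).symm

theorem stdOp_ext {a : SO7} {X Y : Mat} (hX : X ∈ T (a : M)) (hY : Y ∈ T (a : M))
    (h : ∀ Z ∈ mSpace, metricForm 1 1 Z (Ad a⁻¹ X) = metricForm 1 1 Z (Ad a⁻¹ Y)) : X = Y :=
  Ad_injective a⁻¹ (metricForm_ext one_pos one_pos (Ad_inv_mem_mSpace hX) (Ad_inv_mem_mSpace hY) h)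

theorem metricForm_Ad_inv_mul (lam mu : ℝ) (a : SO7) {h : SO7} (hh : h ∈ U3) {X Z : Mat}
    (hX : X ∈ T (a : M)) (hZ : Z ∈ mSpace) :
    metricForm lam mu Z (Ad a⁻¹ X) = metricForm lam mu (Ad h⁻¹ Z) (Ad (a * h)⁻¹ X) := by
  rw [_root_.mul_inv_rev, Ad_mul, metricForm_Ad _ _ (U3.inv_mem hh) hZ (Ad_inv_mem_mSpace hX)]

/-- `matI` does not involve λ and μ, so it may be tested with the metric λ = μ = 1. -/
theorem stdOp_matI_mul (a : SO7) {h : SO7} (hh : h ∈ U3) {X : Mat} (hX : X ∈ T (a : M)) :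
    stdOp matI (a * h) X = stdOp matI a X := by
  have m1 : stdOp matI (a * h) X ∈ T (a : M) := mul_mk_eq (a := a) hh ▸ stdOp_mem _ _ _
  refine stdOp_ext m1 (stdOp_mem _ _ _) fun Z hZ => ?_
  rw [metricForm_Ad_inv_mul 1 1 a hh m1 hZ, metricForm_matI, metricForm_matI,
    _root_.mul_inv_rev, Ad_mul, omegaI_Ad _ _ (U3.inv_mem hh) hZ (Ad_inv_mem_mSpace hX)]

/-- The metric is nondegenerate, so the endomorphism is determined by its form. The form is
evaluated after applying `h⁻¹`, which contributes the conjugate of det h. -/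
theorem stdOp_matJ_mul {lam mu : ℝ} (hl : 0 < lam) (hm : 0 < mu) (hlm : lam * mu = 1) (z : ℂ)
    (a : SO7) {h : SO7} (hh : h ∈ U3) {X : Mat} (hX : X ∈ T (a : M)) :
    stdOp (matJ lam mu z) (a * h) X = stdOp (matJ lam mu (z * star (cdet h))) a X := by
  have m1 : stdOp (matJ lam mu z) (a * h) X ∈ T (a : M) :=
    mul_mk_eq (a := a) hh ▸ stdOp_mem _ _ _
  refine Ad_injective a⁻¹ (metricForm_ext hl hm (Ad_inv_mem_mSpace m1)
    (Ad_inv_mem_mSpace (stdOp_mem _ _ _)) fun Z hZ => ?_)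
  rw [metricForm_Ad_inv_mul lam mu a hh m1 hZ, metricForm_matJ hlm, metricForm_matJ hlm,
    _root_.mul_inv_rev, Ad_mul, omegaC_Ad (U3.inv_mem hh) hZ (Ad_inv_mem_mSpace hX), cdet_inv,
    mul_assoc]

theorem exists_mem_U3 {a b : SO7} (h : (b : M) = a) : ∃ u ∈ U3, b = a * u :=
  ⟨a⁻¹ * b, QuotientGroup.eq.1 h.symm, by simp⟩

/-- Keeping the point `m` apart from its lifts gives both sides the same type. -/
theorem endAt_matI_eq {m : M} {a b : SO7} (ha : (a : M) = m) (hb : (b : M) = m) :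
    endAt b hb matI = endAt a ha matI := by
  subst ha
  obtain ⟨u, hu, rfl⟩ := exists_mem_U3 hb
  ext X : 2
  exact stdOp_matI_mul a hu X.2

theorem endAt_matJ_mul {lam mu : ℝ} (hl : 0 < lam) (hm : 0 < mu) (hlm : lam * mu = 1) (z : ℂ)
    {m : M} {a u : SO7} (hu : u ∈ U3) (ha : (a : M) = m) (hb : ((a * u : SO7) : M) = m) :
    endAt (a * u) hb (matJ lam mu z) = endAt a ha (matJ lam mu (z * star (cdet u))) := by
  subst ha
  ext X : 2
  exact stdOp_matJ_mul hl hm hlm z a hu X.2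

/-- The span of the standard endomorphisms `I`, `J`, `K` with respect to the lift `a` of `m`. -/
def stdSpan (lam mu : ℝ) {m : M} (a : SO7) (ha : (a : M) = m) :
    Submodule ℝ (Module.End ℝ (T m)) :=
  Submodule.span ℝ {endAt a ha matI, endAt a ha (matJ lam mu 1),
    endAt a ha (matJ lam mu (-Complex.I))}

theorem endAt_matI_mem (lam mu : ℝ) {m : M} (a : SO7) (ha : (a : M) = m) :
    endAt a ha matI ∈ stdSpan lam mu a ha :=
  Submodule.subset_span (by simp)

theorem endAt_matJ_mem (lam mu : ℝ) {m : M} (a : SO7) (ha : (a : M) = m) (z : ℂ) :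
    endAt a ha (matJ lam mu z) ∈ stdSpan lam mu a ha := by
  have e : matJ lam mu z = z.re • matJ lam mu 1 + (-z.im) • matJ lam mu (-Complex.I) := by
    rw [← matJ_smul, ← matJ_smul, ← matJ_add]
    congr 1
    apply Complex.ext <;> simp
  rw [e, map_add, map_smul, map_smul]
  exact add_mem (Submodule.smul_mem _ _ (Submodule.subset_span (by simp)))
    (Submodule.smul_mem _ _ (Submodule.subset_span (by simp)))

/-- Multiplication by the unit number z is an invertible rotation of the plane of J and K; `e1` and
`e2` are the inverse rotation. -/
theorem stdSpan_eq_span {lam mu : ℝ} {m : M} (a : SO7) (ha : (a : M) = m) {z : ℂ}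
    (hz : z * star z = 1) :
    stdSpan lam mu a ha = Submodule.span ℝ {endAt a ha matI, endAt a ha (matJ lam mu z),
      endAt a ha (matJ lam mu (-Complex.I * z))} := by
  have h : z.re * z.re + z.im * z.im = 1 := by
    have := congrArg Complex.re hz
    simpa using this
  apply le_antisymm
  · have e1 : matJ lam mu 1 = z.re • matJ lam mu z + z.im • matJ lam mu (-Complex.I * z) := by
      rw [← matJ_smul, ← matJ_smul, ← matJ_add]
      congr 1
      apply Complex.ext <;> simp
      · linarith
      · ring
    have e2 : matJ lam mu (-Complex.I) =
        (-z.im) • matJ lam mu z + z.re • matJ lam mu (-Complex.I * z) := by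
      rw [← matJ_smul, ← matJ_smul, ← matJ_add]
      congr 1
      apply Complex.ext <;> simp
      · ring
      · linarith
    rw [stdSpan, Submodule.span_le]
    rintro x (rfl | rfl | rfl)
    · exact Submodule.subset_span (by simp)
    · rw [e1, map_add, map_smul, map_smul]
      exact add_mem (Submodule.smul_mem _ _ (Submodule.subset_span (by simp)))
        (Submodule.smul_mem _ _ (Submodule.subset_span (by simp)))
    · rw [e2, map_add, map_smul, map_smul]
      exact add_mem (Submodule.smul_mem _ _ (Submodule.subset_span (by simp)))
        (Submodule.smul_mem _ _ (Submodule.subset_span (by simp)))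
  · rw [Submodule.span_le]
    rintro x (rfl | rfl | rfl)
    · exact endAt_matI_mem _ _ _ _
    · exact endAt_matJ_mem _ _ _ _ _
    · exact endAt_matJ_mem _ _ _ _ _

theorem stdSpan_eq {lam mu : ℝ} (hl : 0 < lam) (hm : 0 < mu) (hlm : lam * mu = 1) {m : M}
    {a b : SO7} (ha : (a : M) = m) (hb : (b : M) = m) :
    stdSpan lam mu b hb = stdSpan lam mu a ha := by
  obtain ⟨u, hu, rfl⟩ := exists_mem_U3 (hb.trans ha.symm)
  have hz : star (cdet u) * star (star (cdet u)) = 1 := by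
    rw [star_star, mul_comm, cdet_mul_star hu]
  rw [stdSpan, endAt_matI_eq ha hb, endAt_matJ_mul hl hm hlm _ hu ha hb,
    endAt_matJ_mul hl hm hlm _ hu ha hb, one_mul, ← stdSpan_eq_span a ha hz]

/-! ### Standard metrics and structures -/

theorem metricForm_eq_of_lift (lam mu : ℝ) {a b : SO7} (hb : (b : M) = a) {X Y : Mat}
    (hX : X ∈ T (a : M)) (hY : Y ∈ T (a : M)) :
    metricForm lam mu (Ad b⁻¹ X) (Ad b⁻¹ Y) = metricForm lam mu (Ad a⁻¹ X) (Ad a⁻¹ Y) := by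
  obtain ⟨u, hu, rfl⟩ := exists_mem_U3 hb
  rw [metricForm_Ad_inv_mul lam mu a hu hY (Ad_inv_mem_mSpace hX), _root_.mul_inv_rev, Ad_mul,
    Ad_mul]

theorem smoothOn_const {V : Type*} [NormedAddCommGroup V] [NormedSpace ℝ V] (v : V)
    (W : Set SO7) : SmoothOn (fun _ => v) W := fun _ _ =>
  ⟨Set.univ, fun _ => v, isOpen_univ, trivial, contDiffOn_const, fun _ _ _ => rfl⟩

theorem exists_lift (m : M) : ∃ a : SO7, (a : M) = m := ⟨m.out, Quotient.out_eq m⟩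

/-- The lift of a point of `M` to `SO(7)` by the axiom of choice. -/
def lift (m : M) : SO7 := m.out

theorem lift_eq (m : M) : (lift m : M) = m := Quotient.out_eq m

/-- The metric `g_{λ,μ}`. -/
def stdMetric {lam mu : ℝ} (hl : 0 < lam) (hm : 0 < mu) : RiemMetric where
  inner m := (metricBilin lam mu).compl₁₂ (Ad (lift m)⁻¹ ∘ₗ (T m).subtype)
    (Ad (lift m)⁻¹ ∘ₗ (T m).subtype)
  symm m X Y := metricForm_comm _ _ _ _
  pos m X hX := metricForm_pos hl hm (X.2 _ (lift_eq m)) fun h => hX (Subtype.ext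
    (Ad_injective _ (h.trans (map_zero _).symm)))
  smooth i j := by
    -- The Gram matrix of the frame is constant, so the arbitrary choice of `lift` does no harm to
    -- smoothness.
    have : ∀ a : SO7, metricForm lam mu (Ad (lift (a : M))⁻¹ (frame a i))
        (Ad (lift (a : M))⁻¹ (frame a j)) = metricForm lam mu (basisM i) (basisM j) := fun a => by
      rw [metricForm_eq_of_lift lam mu (lift_eq _) (frame a i).2 (frame a j).2, frame, frame,
        Ad_inv_self, Ad_inv_self]
    simp only [LinearMap.compl₁₂_apply, LinearMap.comp_apply, Submodule.subtype_apply,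
      metricBilin_apply, this]
    exact smoothOn_const _ _

theorem stdMetric_isStandard {lam mu : ℝ} (hl : 0 < lam) (hm : 0 < mu) :
    (stdMetric hl hm).IsStandard lam mu := fun _ X Y =>
  metricForm_eq_of_lift lam mu (lift_eq _) X.2 Y.2

theorem RiemMetric.IsStandard.ext {g g' : RiemMetric} {lam mu : ℝ} (h : g.IsStandard lam mu)
    (h' : g'.IsStandard lam mu) : g = g' := by
  apply RiemMetric.ext
  funext m
  obtain ⟨a, rfl⟩ := exists_lift m
  ext X Y
  rw [h, h']

theorem Ad_inv_frame (a : SO7) (i : Fin 4 × Fin 3) : Ad a⁻¹ (frame a i : Mat) = basisM i :=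
  Ad_inv_self a _

theorem metricForm_basisM (lam mu : ℝ) (i j : Fin 4 × Fin 3) :
    metricForm lam mu (basisM i) (basisM j) = if i = j then wt lam mu i.1 else 0 := by
  rw [metricForm_basisM_left, coM_basisM]
  simp

theorem RiemMetric.IsStandard.inner_frame {g : RiemMetric} {lam mu : ℝ}
    (h : g.IsStandard lam mu) (a : SO7) (i j : Fin 4 × Fin 3) :
    g.inner a (frame a i) (frame a j) = if i = j then wt lam mu i.1 else 0 := by
  rw [h, Ad_inv_frame, Ad_inv_frame, metricForm_basisM]

theorem frame_ne_zero (a : SO7) (i : Fin 4 × Fin 3) : frame a i ≠ 0 := by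
  rw [← frameBasis_apply]
  exact (frameBasis a).ne_zero i

theorem RiemMetric.IsStandard.pos_left {g : RiemMetric} {lam mu : ℝ}
    (h : g.IsStandard lam mu) : 0 < lam := by
  have := g.pos _ _ (frame_ne_zero 1 (0, 0))
  rw [h.inner_frame] at this
  simpa [wt] using this

theorem RiemMetric.IsStandard.pos_right {g : RiemMetric} {lam mu : ℝ}
    (h : g.IsStandard lam mu) : 0 < mu := by
  have := g.pos _ _ (frame_ne_zero 1 (2, 0))
  rw [h.inner_frame] at this
  simpa [wt] using this

theorem RiemMetric.IsStandard.parameters {g : RiemMetric} {lam mu lam' mu' : ℝ}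
    (h : g.IsStandard lam mu) (h' : g.IsStandard lam' mu') : lam = lam' ∧ mu = mu' := by
  constructor
  · simpa [wt] using (h.inner_frame 1 (0, 0) (0, 0)).symm.trans (h'.inner_frame 1 (0, 0) (0, 0))
  · simpa [wt] using (h.inner_frame 1 (2, 0) (2, 0)).symm.trans (h'.inner_frame 1 (2, 0) (2, 0))

/-- Each weight occurs six times. The value is written as a square because the volume density is its
root. -/
theorem det_wt (lam mu : ℝ) :
    det (of fun i j : Fin 4 × Fin 3 => if i = j then wt lam mu i.1 else 0) =
      ((lam * mu) ^ 3) ^ 2 := by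
  have : (of fun i j : Fin 4 × Fin 3 => if i = j then wt lam mu i.1 else 0) =
      diagonal fun i => wt lam mu i.1 := by
    ext i j
    simp [diagonal_apply]
  rw [this, det_diagonal]
  simp [Fintype.prod_prod_type, Fin.prod_univ_four, wt]
  ring

theorem RiemMetric.IsStandard.isNormalised_iff {g : RiemMetric} {lam mu : ℝ}
    (h : g.IsStandard lam mu) : g.IsNormalised ↔ lam * mu = 1 := by
  have hp : 0 < lam * mu := mul_pos h.pos_left h.pos_right
  simp only [RiemMetric.IsNormalised, h.inner_frame, det_wt,
    Real.sqrt_sq (pow_pos hp 3).le, forall_const]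
  exact pow_eq_one_iff_of_nonneg hp.le (by norm_num)

theorem RiemMetric.IsStandard.isInvariant {g : RiemMetric} {lam mu : ℝ}
    (h : g.IsStandard lam mu) : g.IsInvariant := by
  intro b m X Y
  obtain ⟨a, rfl⟩ := exists_lift m
  refine (h (b * a) _ _).trans ?_
  rw [h]
  simp only [push, LinearEquiv.coe_mk, LinearMap.coe_mk, AddHom.coe_mk, _root_.mul_inv_rev, Ad_mul,
    Ad_inv_self]

theorem RiemMetric.ext_right (g : RiemMetric) {m : M} {X Y : T m}
    (h : ∀ Z, g.inner m Z X = g.inner m Z Y) : X = Y := by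
  by_contra hne
  have := g.pos m (X - Y) (sub_ne_zero.2 hne)
  rw [map_sub, h, sub_self] at this
  exact this.false

/-! ### Quaternionic triples -/

theorem IsQuaternionicTriple.K_sq {V : Type*} [AddCommGroup V] [Module ℝ V]
    {g : LinearMap.BilinForm ℝ V} {I J K : Module.End ℝ V} (h : IsQuaternionicTriple g I J K) :
    K * K = -1 := by
  calc K * K = -(J * I * (I * J)) := by rw [h.J_mul_I, h.I_mul_J, neg_mul, neg_neg]
    _ = -(J * (I * I) * J) := by simp only [mul_assoc]
    _ = -1 := by rw [h.I_sq, mul_neg, mul_one, neg_mul, h.J_sq, neg_neg]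

theorem IsQuaternionicTriple.K_mul_I {V : Type*} [AddCommGroup V] [Module ℝ V]
    {g : LinearMap.BilinForm ℝ V} {I J K : Module.End ℝ V} (h : IsQuaternionicTriple g I J K) :
    K * I = J := by
  rw [← neg_neg K, ← h.J_mul_I, neg_mul, mul_assoc, h.I_sq, mul_neg, mul_one, neg_neg]

theorem IsQuaternionicTriple.I_mul_K {V : Type*} [AddCommGroup V] [Module ℝ V]
    {g : LinearMap.BilinForm ℝ V} {I J K : Module.End ℝ V} (h : IsQuaternionicTriple g I J K) :
    I * K = -J := by
  rw [← h.I_mul_J, ← mul_assoc, h.I_sq, neg_mul, one_mul]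

theorem IsQuaternionicTriple.J_mul_K {V : Type*} [AddCommGroup V] [Module ℝ V]
    {g : LinearMap.BilinForm ℝ V} {I J K : Module.End ℝ V} (h : IsQuaternionicTriple g I J K) :
    J * K = I := by
  rw [← h.I_mul_J, ← mul_assoc, h.J_mul_I, ← h.I_mul_J, neg_mul, mul_assoc, h.J_sq, mul_neg,
    mul_one, neg_neg]

theorem IsQuaternionicTriple.K_mul_J {V : Type*} [AddCommGroup V] [Module ℝ V]
    {g : LinearMap.BilinForm ℝ V} {I J K : Module.End ℝ V} (h : IsQuaternionicTriple g I J K) :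
    K * J = -I := by
  rw [← h.I_mul_J, mul_assoc, h.J_sq, mul_neg, mul_one]

theorem IsQuaternionicTriple.linearIndependent {V : Type*} [AddCommGroup V] [Module ℝ V]
    [Nontrivial V] {g : LinearMap.BilinForm ℝ V} {I J K : Module.End ℝ V}
    (h : IsQuaternionicTriple g I J K) : LinearIndependent ℝ ![I, J, K] := by
  rw [Fintype.linearIndependent_iff]
  intro c hc
  simp only [Fin.sum_univ_three, cons_val_zero, cons_val_one, cons_val_two, head_cons,
    tail_cons] at hc
  have hc : c 0 • I + c 1 • J + c 2 • K = 0 := hc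
  -- The mixed products cancel in pairs, so an imaginary quaternion squares to minus its squared
  -- norm.
  have e : (c 0 • I + c 1 • J + c 2 • K) * (c 0 • I + c 1 • J + c 2 • K) =
      (-(c 0 * c 0 + c 1 * c 1 + c 2 * c 2)) • (1 : Module.End ℝ V) := by
    simp only [mul_add, add_mul, smul_mul_smul_comm, h.I_sq, h.J_sq, h.K_sq, h.I_mul_J, h.J_mul_I,
      h.K_mul_I, h.I_mul_K, h.J_mul_K, h.K_mul_J]
    module
  rw [hc, mul_zero] at e
  have e' : c 0 * c 0 + c 1 * c 1 + c 2 * c 2 = 0 := by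
    linarith [(smul_eq_zero.1 e.symm).resolve_right one_ne_zero]
  have p := fun i => mul_self_nonneg (c i)
  intro i
  apply mul_self_eq_zero.1
  fin_cases i <;> simp <;> nlinarith [p 0, p 1, p 2]

theorem omegaI_swap (lam mu : ℝ) (X Y : Mat) : omegaI lam mu X Y = -omegaI lam mu Y X := by
  simp only [omegaI, omega0, omega0', wedgeForm, Fin.sum_univ_three]
  ring

theorem omegaC_swap (X Y : Mat) : omegaC X Y = -omegaC Y X := by
  rw [omegaC, omegaC, neg_sub]

theorem RiemMetric.IsStandard.inner_matI {g : RiemMetric} {lam mu : ℝ} (h : g.IsStandard lam mu)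
    (a : SO7) (X Y : T (a : M)) :
    g.inner a X (endAt a rfl matI Y) = omegaI lam mu (Ad a⁻¹ X) (Ad a⁻¹ Y) := by
  rw [h, coe_endAt, metricForm_matI]

theorem RiemMetric.IsStandard.inner_matJ {g : RiemMetric} {lam mu : ℝ} (h : g.IsStandard lam mu)
    (hlm : lam * mu = 1) (z : ℂ) (a : SO7) (X Y : T (a : M)) :
    g.inner a X (endAt a rfl (matJ lam mu z) Y) = (z * omegaC (Ad a⁻¹ X) (Ad a⁻¹ Y)).re := by
  rw [h, coe_endAt, metricForm_matJ hlm]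

theorem isQuaternionicTriple_endAt {g : RiemMetric} {lam mu : ℝ} (h : g.IsStandard lam mu)
    (hlm : lam * mu = 1) (a : SO7) {z : ℂ} (hz : z * star z = 1) :
    IsQuaternionicTriple (g.inner a) (endAt a rfl matI) (endAt a rfl (matJ lam mu z))
      (endAt a rfl (matJ lam mu (-Complex.I * z))) := by
  have hI : endAt a rfl matI * endAt a rfl matI = -1 := by
    rw [← map_mul, matI_sq, map_neg, map_one]
  have hJ : endAt a rfl (matJ lam mu z) * endAt a rfl (matJ lam mu z) = -1 := by
    rw [← map_mul, matJ_sq hlm hz, map_neg, map_one]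
  refine ⟨hI, hJ, ?_, ?_, fun X Y => ?_, fun X Y => ?_⟩
  · rw [← map_mul, matI_mul_matJ]
  · rw [← map_mul, matJ_mul_matI, map_neg]
  -- Skewness of the form gives g(IX, IY) = -g(Y, I²X), and I² = -1 finishes.
  · rw [h.inner_matI, omegaI_swap, ← h.inner_matI, ← Module.End.mul_apply, hI]
    simp [g.symm _ X Y]
  · rw [h.inner_matJ hlm, omegaC_swap, mul_neg, Complex.neg_re, ← h.inner_matJ hlm,
      ← Module.End.mul_apply, hJ]
    simp [g.symm _ X Y]

theorem AQHStructure.isStandard_iff {Q : AQHStructure} {lam mu : ℝ} (h : Q.g.IsStandard lam mu)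
    (hlm : lam * mu = 1) : Q.IsStandard lam mu ↔ ∀ a : SO7, Q.G a = stdSpan lam mu a rfl := by
  have hJ : ∀ (a : SO7) (X Y : T (a : M)), Q.g.inner a X (endAt a rfl (matJ lam mu 1) Y) =
      omegaJ (Ad a⁻¹ X) (Ad a⁻¹ Y) := fun a X Y => by
    rw [h.inner_matJ hlm, omegaC_eq]
    simp
  have hK : ∀ (a : SO7) (X Y : T (a : M)),
      Q.g.inner a X (endAt a rfl (matJ lam mu (-Complex.I)) Y) =
      omegaK (Ad a⁻¹ X) (Ad a⁻¹ Y) := fun a X Y => by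
    rw [h.inner_matJ hlm, omegaC_eq]
    simp
  constructor
  · rintro ⟨-, hQ⟩ a
    obtain ⟨I, J, K, h1, h2, h3, -, h5⟩ := hQ a
    have e1 : I = endAt a rfl matI := LinearMap.ext fun Y => Q.g.ext_right fun X => by
      rw [h1, h.inner_matI]
    have e2 : J = endAt a rfl (matJ lam mu 1) := LinearMap.ext fun Y => Q.g.ext_right fun X => by
      rw [h2, hJ]
    have e3 : K = endAt a rfl (matJ lam mu (-Complex.I)) :=
      LinearMap.ext fun Y => Q.g.ext_right fun X => by rw [h3, hK]
    rw [h5, e1, e2, e3, stdSpan]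
  · intro hQ
    refine ⟨h, fun a => ⟨_, _, _, h.inner_matI a, hJ a, hK a, ?_, hQ a⟩⟩
    simpa using isQuaternionicTriple_endAt h hlm a (z := 1) (by simp)

/-- The coefficient p(JA) is computed twice. Compatibility gives λ = g(JA, JA) = ω_J(JA, A) = p(JA),
while μ p(JA) = g(P, JA) = ω_J(P, A) = 1. -/
theorem AQHStructure.IsStandard.mul_eq_one {Q : AQHStructure} {lam mu : ℝ}
    (h : Q.IsStandard lam mu) : lam * mu = 1 := by
  obtain ⟨hg, hQ⟩ := h
  obtain ⟨I, J, K, -, h2, -, h4, -⟩ := hQ 1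
  have e0 : ∀ (k : Fin 4) (i : Fin 4 × Fin 3) (l : Fin 3), coM (k, l) (basisM i) =
      if (k, l) = i then 1 else 0 := fun k i l => coM_basisM _ _
  have e1 : Q.g.inner _ (J (frame 1 (0, 0))) (J (frame 1 (0, 0))) = lam := by
    rw [h4.J_compat, hg.inner_frame]
    simp [wt]
  have e2 : Q.g.inner _ (J (frame 1 (0, 0))) (J (frame 1 (0, 0))) =
      coM (2, 0) (Ad 1⁻¹ (J (frame 1 (0, 0)) : T _)) := by
    rw [h2, Ad_inv_frame]
    simp [omegaJ, wedgeForm, e0]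
  have e3 : Q.g.inner _ (frame 1 (2, 0)) (J (frame 1 (0, 0))) =
      mu * coM (2, 0) (Ad 1⁻¹ (J (frame 1 (0, 0)) : T _)) := by
    rw [hg, Ad_inv_frame, metricForm_basisM_left]
    simp [wt]
  have e4 : Q.g.inner _ (frame 1 (2, 0)) (J (frame 1 (0, 0))) = 1 := by
    rw [h2, Ad_inv_frame, Ad_inv_frame]
    simp [omegaJ, wedgeForm, e0]
  rw [← e1, e2, mul_comm, ← e3, e4]

theorem AQHStructure.IsStandard.ext {Q Q' : AQHStructure} {lam mu : ℝ} (h : Q.IsStandard lam mu)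
    (h' : Q'.IsStandard lam mu) : Q = Q' := by
  apply AQHStructure.ext
  · exact h.1.ext h'.1
  · funext m
    obtain ⟨a, rfl⟩ := exists_lift m
    rw [(isStandard_iff h.1 h.mul_eq_one).1 h a, (isStandard_iff h'.1 h.mul_eq_one).1 h' a]

/-! ### Existence of the standard structure -/

theorem contDiff_entry (i j : Fin 7) : ContDiff ℝ ∞ fun Y : Mat => Y i j :=
  contDiff_apply_apply ℝ ℝ i j

theorem contDiff_of_entry {f : Mat → Mat} (h : ∀ i j, ContDiff ℝ ∞ fun Y => f Y i j) :
    ContDiff ℝ ∞ f :=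
  contDiff_pi.2 fun i => contDiff_pi.2 fun j => h i j

theorem contDiff_mul_mul_transpose (B : Mat) : ContDiff ℝ ∞ fun Y : Mat => Y * B * Yᵀ := by
  refine contDiff_of_entry fun i j => ?_
  simp only [Matrix.mul_apply, transpose_apply]
  exact ContDiff.sum fun k _ => (ContDiff.sum fun l _ =>
    (contDiff_entry _ _).mul contDiff_const).mul (contDiff_entry _ _)

theorem contDiff_cdet (B : Mat) : ContDiff ℝ ∞ fun Y : Mat => cdet (B * Y) := by
  have h : ∀ i j, ContDiff ℝ ∞ fun Y : Mat => linPart (B * Y) i j := fun i j => by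
    simp only [linPart, Matrix.smul_apply, Matrix.mul_apply, map_apply, smul_eq_mul]
    refine contDiff_const.mul (ContDiff.sum fun k _ => (ContDiff.sum fun l _ =>
      contDiff_const.mul ?_).mul contDiff_const)
    have e : ContDiff ℝ ∞ fun Y : Mat => (B * Y) l k := by
      simp only [Matrix.mul_apply]
      exact ContDiff.sum fun l _ => contDiff_const.mul (contDiff_entry _ _)
    exact Complex.ofRealCLM.contDiff.comp e
  simp only [cdet, det_fin_three]
  fun_prop

/-- A phase on `SO(7)` near `b` with `phase b (a * u) = phase b a * cdet u` for `u ∈ U(3)`. -/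
def phase (b : SO7) (Y : Mat) : ℂ :=
  cdet (((b⁻¹ : SO7) : Mat) * Y) / (‖cdet (((b⁻¹ : SO7) : Mat) * Y)‖ : ℝ)

theorem norm_cdet {u : SO7} (hu : u ∈ U3) : ‖cdet u‖ = 1 := by
  have := congrArg norm (cdet_mul_star hu)
  rw [norm_mul, norm_star, norm_one] at this
  exact (mul_self_eq_one_iff.1 this).resolve_right fun h => by linarith [norm_nonneg (cdet u)]

theorem phase_mul (b a : SO7) {u : SO7} (hu : u ∈ U3) :
    phase b ((a * u : SO7) : Mat) = phase b a * cdet u := by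
  rw [phase, Submonoid.coe_mul, ← mul_assoc, cdet_mul _ hu, norm_mul, norm_cdet hu, mul_one, phase]
  ring

theorem phase_mul_star {b : SO7} {Y : Mat} (h : cdet (((b⁻¹ : SO7) : Mat) * Y) ≠ 0) :
    phase b Y * star (phase b Y) = 1 := by
  have : ‖phase b Y‖ = 1 := by
    rw [phase, norm_div, Complex.norm_real, norm_norm, div_self (norm_ne_zero_iff.2 h)]
  have e := Complex.mul_conj (phase b Y)
  rw [Complex.normSq_eq_norm_sq, this] at e
  simpa using e

theorem contDiffOn_phase (b : SO7) :
    ContDiffOn ℝ ∞ (phase b) {Y | cdet (((b⁻¹ : SO7) : Mat) * Y) ≠ 0} := by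
  have h := (contDiff_cdet ((b⁻¹ : SO7) : Mat)).contDiffOn
    (s := {Y | cdet (((b⁻¹ : SO7) : Mat) * Y) ≠ 0})
  have hn : ContDiffOn ℝ ∞ (fun Y : Mat => ((‖cdet (((b⁻¹ : SO7) : Mat) * Y)‖ : ℝ) : ℂ))
      {Y | cdet (((b⁻¹ : SO7) : Mat) * Y) ≠ 0} :=
    Complex.ofRealCLM.contDiff.comp_contDiffOn (h.norm ℝ fun _ hY => hY)
  have e : phase b = fun Y => cdet (((b⁻¹ : SO7) : Mat) * Y) *
      ((‖cdet (((b⁻¹ : SO7) : Mat) * Y)‖ : ℝ) : ℂ)⁻¹ := funext fun _ => div_eq_mul_inv _ _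
  rw [e]
  exact h.mul (hn.inv fun Y hY => Complex.ofReal_ne_zero.2 (norm_ne_zero_iff.2 hY))

theorem matJ_apply (lam mu : ℝ) (z : ℂ) (i j : Fin 4) :
    matJ lam mu z i j = z.re * matJ lam mu 1 i j + z.im * matJ lam mu Complex.I i j := by
  have : z = z.re * 1 + z.im * Complex.I := by rw [mul_one, Complex.re_add_im]
  conv_lhs => rw [this, matJ_add, matJ_smul, matJ_smul]
  rfl

theorem stdOp_frame (L : Matrix (Fin 4) (Fin 4) ℝ) (a : SO7) (i : Fin 4 × Fin 3) :
    stdOp L a (frame a i) = ∑ j, L j i.1 • Ad a (basisM (j, i.2)) := by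
  rw [stdOp_apply, Ad_inv_frame]
  obtain ⟨i, k⟩ := i
  simp [coM_basisM, Fintype.sum_prod_type, Prod.mk.injEq, ite_and, ite_smul]

/-- On `SO(7)` the inverse is the transpose, so the frame extends to all matrices as the polynomial
map `Y * B * Yᵀ`. -/
theorem smoothOn_stdOp {W : Set SO7} {O : Set Mat} (hO : IsOpen O) (hW : ∀ a ∈ W, (a : Mat) ∈ O)
    {L : Mat → Matrix (Fin 4) (Fin 4) ℝ} (hL : ∀ i j, ContDiffOn ℝ ∞ (fun Y => L Y i j) O)
    (i : Fin 4 × Fin 3) : SmoothOn (fun a => stdOp (L a) a (frame a i)) W := fun a ha =>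
  ⟨O, fun Y => ∑ j, L Y j i.1 • (Y * basisM (j, i.2) * Yᵀ), hO, hW a ha,
    ContDiffOn.sum fun j _ => (hL j i.1).smul (contDiff_mul_mul_transpose _).contDiffOn,
    fun _ _ _ => stdOp_frame _ _ _⟩

theorem isOpen_of_preimage {U : Set M} {O : Set Mat} (hO : IsOpen O)
    (hU : ∀ a : SO7, (a : M) ∈ U ↔ (a : Mat) ∈ O) : IsOpen U := by
  have e : (QuotientGroup.mk : SO7 → M) ⁻¹' U = Subtype.val ⁻¹' O := Set.ext hU
  have : IsOpen ((QuotientGroup.mk : SO7 → M) ⁻¹' U) := by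
    rw [e]
    exact hO.preimage continuous_subtype_val
  exact this

/-- A local field of endomorphisms `Re(w z)J - Im(w z)K`, where `z` is the phase based at `b`. -/
def fieldJ (lam mu : ℝ) (b : SO7) (w : ℂ) (m : M) : Module.End ℝ (T m) :=
  endAt (lift m) (lift_eq m) (matJ lam mu (w * phase b (lift m)))

/-- Changing the lift by `u` multiplies the phase by det u and the form by its conjugate. The two
cancel, so the field can be computed with any lift, in particular with a smoothly varying one. -/
theorem fieldJ_mk {lam mu : ℝ} (hl : 0 < lam) (hm : 0 < mu) (hlm : lam * mu = 1) (b : SO7)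
    (w : ℂ) (a : SO7) : fieldJ lam mu b w a = endAt a rfl (matJ lam mu (w * phase b a)) := by
  obtain ⟨u, hu, e⟩ := exists_mem_U3 (lift_eq (a : M))
  have : ∀ (c : SO7) (hc : (c : M) = a), c = a * u →
      endAt c hc (matJ lam mu (w * phase b c)) = endAt a rfl (matJ lam mu (w * phase b a)) := by
    rintro c hc rfl
    rw [endAt_matJ_mul hl hm hlm _ hu rfl hc, phase_mul b a hu, mul_assoc, mul_assoc,
      cdet_mul_star hu, mul_one]
  exact this _ (lift_eq _) e

/-- The almost quaternion-Hermitian structure given by `(λ, μ)`. -/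
def stdStructure {lam mu : ℝ} (hl : 0 < lam) (hm : 0 < mu) (hlm : lam * mu = 1) :
    AQHStructure where
  g := stdMetric hl hm
  G m := stdSpan lam mu (lift m) (lift_eq m)
  local_basis m₀ := by
    set b := lift m₀
    let O : Set Mat := {Y | cdet (((b⁻¹ : SO7) : Mat) * Y) ≠ 0}
    have hO : IsOpen O :=
      isOpen_compl_singleton.preimage (contDiff_cdet ((b⁻¹ : SO7) : Mat)).continuous
    let U : Set M := {m | (lift m : Mat) ∈ O}
    -- Right translation by `U(3)` multiplies `cdet` by a number of modulus one, so nonvanishing is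
    -- a condition on the coset.
    have hU : ∀ a : SO7, (a : M) ∈ U ↔ (a : Mat) ∈ O := fun a => by
      obtain ⟨u, hu, e⟩ := exists_mem_U3 (lift_eq (a : M))
      change cdet _ ≠ 0 ↔ cdet _ ≠ 0
      rw [e, Submonoid.coe_mul, ← mul_assoc, cdet_mul _ hu, mul_ne_zero_iff, and_iff_left]
      intro h
      simpa [h] using norm_cdet hu
    have hp : ContDiffOn ℝ ∞ (phase b) O := contDiffOn_phase b
    have hJ : ∀ w, SmoothEndOn (fieldJ lam mu b w) U := fun w i => by
      simp only [fieldJ_mk hl hm hlm, coe_endAt]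
      refine smoothOn_stdOp hO (fun a ha => (hU a).1 ha)
        (L := fun Y => matJ lam mu (w * phase b Y)) (fun i j => ?_) i
      have hw : ContDiffOn ℝ ∞ (fun Y => w * phase b Y) O := contDiffOn_const.mul hp
      simp only [matJ_apply lam mu (w * phase b _)]
      exact ((Complex.reCLM.contDiff.comp_contDiffOn hw).mul contDiffOn_const).add
        ((Complex.imCLM.contDiff.comp_contDiffOn hw).mul contDiffOn_const)
    refine ⟨U, fun m => endAt (lift m) (lift_eq m) matI, fieldJ lam mu b 1,
      fieldJ lam mu b (-Complex.I), ?_, ?_, ?_, hJ _, hJ _, ?_⟩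
    · exact isOpen_of_preimage hO hU
    · change cdet (((b⁻¹ : SO7) : Mat) * (b : Mat)) ≠ 0
      rw [← Submonoid.coe_mul, inv_mul_cancel, Submonoid.coe_one, cdet_one]
      exact one_ne_zero
    · intro i
      have : ∀ a : SO7, endAt (lift (a : M)) (lift_eq (a : M)) matI = endAt a rfl matI :=
        fun a => endAt_matI_eq rfl _
      simp only [this, coe_endAt]
      exact smoothOn_stdOp isOpen_univ (fun _ _ => trivial) (L := fun _ => matI)
        (fun _ _ => contDiffOn_const) i
    · intro m hmU
      obtain ⟨a, rfl⟩ := exists_lift m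
      have hz := phase_mul_star ((hU a).1 hmU)
      have ht := isQuaternionicTriple_endAt (stdMetric_isStandard hl hm) hlm a hz
      beta_reduce
      rw [endAt_matI_eq (rfl : (a : M) = a) (lift_eq _), fieldJ_mk hl hm hlm, fieldJ_mk hl hm hlm,
        one_mul, stdSpan_eq hl hm hlm (rfl : (a : M) = a) (lift_eq _), stdSpan_eq_span a rfl hz]
      have : Nontrivial (T (a : M)) := ⟨_, _, frame_ne_zero a (0, 0)⟩
      exact ⟨ht, ht.linearIndependent, rfl⟩

theorem stdStructure_isStandard {lam mu : ℝ} (hl : 0 < lam) (hm : 0 < mu) (hlm : lam * mu = 1) :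
    (stdStructure hl hm hlm).IsStandard lam mu :=
  (AQHStructure.isStandard_iff (stdMetric_isStandard hl hm) hlm).2 fun _ =>
    stdSpan_eq hl hm hlm _ _

theorem push_endAt {m : M} {a : SO7} (ha : (a : M) = m) (b : SO7) (hb : ((b * a : SO7) : M) = b • m)
    (L : Matrix (Fin 4) (Fin 4) ℝ) : (push b m).conj (endAt a ha L) = endAt (b * a) hb L := by
  ext X : 2
  rw [coe_endAt, stdOp_mul_left]
  rfl

theorem map_push_stdSpan (lam mu : ℝ) {m : M} {a : SO7} (ha : (a : M) = m) (b : SO7)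
    (hb : ((b * a : SO7) : M) = b • m) :
    (stdSpan lam mu a ha).map (push b m).conj.toLinearMap = stdSpan lam mu (b * a) hb := by
  rw [stdSpan, Submodule.map_span, Set.image_insert_eq, Set.image_insert_eq, Set.image_singleton]
  simp only [LinearEquiv.coe_coe]
  rw [push_endAt ha b hb, push_endAt ha b hb, push_endAt ha b hb, stdSpan]

theorem AQHStructure.IsStandard.isInvariant {Q : AQHStructure} {lam mu : ℝ}
    (h : Q.IsStandard lam mu) : Q.IsInvariant := by
  refine ⟨h.1.isInvariant, fun b m => ?_⟩
  obtain ⟨a, rfl⟩ := exists_lift m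
  have hG := (isStandard_iff h.1 h.mul_eq_one).1 h
  rw [hG a, map_push_stdSpan lam mu rfl b rfl]
  exact (hG (b * a)).symm

/-! ### Signed permutations in `U(3)` -/

/-- The matrix sending `e_c` to `s c • e_{π c}`. -/
def signedPerm (π : Equiv.Perm (Fin 7)) (s : Fin 7 → ℤ) : Mat :=
  of fun r c => if r = π c then (s c : ℝ) else 0

theorem signedPerm_mul_apply (π : Equiv.Perm (Fin 7)) (s : Fin 7 → ℤ) (X : Mat) (r c : Fin 7) :
    (signedPerm π s * X) (π r) c = s r * X r c := by
  simp [signedPerm, Matrix.mul_apply]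

theorem mul_signedPerm_apply (π : Equiv.Perm (Fin 7)) (s : Fin 7 → ℤ) (X : Mat) (r c : Fin 7) :
    (X * signedPerm π s) r c = X r (π c) * s c := by
  simp [signedPerm, Matrix.mul_apply]

theorem signedPerm_mul (π π' : Equiv.Perm (Fin 7)) (s s' : Fin 7 → ℤ) :
    signedPerm π s * signedPerm π' s' = signedPerm (π * π') fun c => s (π' c) * s' c := by
  ext r c
  rw [mul_signedPerm_apply]
  simp [signedPerm]

theorem signedPerm_mem (π : Equiv.Perm (Fin 7)) (s : Fin 7 → ℤ) (hs : ∀ c, s c * s c = 1)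
    (hd : (Equiv.Perm.sign π : ℤ) * ∏ c, s c = 1) :
    signedPerm π s ∈ specialOrthogonalGroup (Fin 7) ℝ := by
  rw [mem_specialOrthogonalGroup_iff]
  constructor
  · rw [mem_orthogonalGroup_iff']
    ext r c
    rw [mul_signedPerm_apply, transpose_apply, signedPerm, of_apply,
      one_apply]
    by_cases h : r = c
    · subst h
      simpa using by exact_mod_cast hs r
    · simp [h, Ne.symm h]
  · have : signedPerm π s = (π⁻¹).permMatrix ℝ * diagonal fun c => (s c : ℝ) := by
      ext r c
      rw [mul_diagonal]
      simp [signedPerm, Equiv.Perm.permMatrix, Equiv.toPEquiv_apply, PEquiv.toMatrix_apply,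
        Equiv.symm_apply_eq]
    rw [this, det_mul, det_permutation, det_diagonal, Equiv.Perm.sign_inv]
    exact_mod_cast hd

/-- The integer entries of `wedge a b`. -/
def wedgeZ (a b i j : Fin 7) : ℤ :=
  (if i = b ∧ j = a then 1 else 0) - (if i = a ∧ j = b then 1 else 0)

theorem cast_wedgeZ (a b i j : Fin 7) : (wedgeZ a b i j : ℝ) = wedge a b i j := by
  rw [wedge_apply, wedgeZ]
  push_cast
  rfl

/-- The integer entries of `matE`. -/
def matEZ (i j : Fin 7) : ℤ := wedgeZ 1 4 i j + wedgeZ 2 5 i j + wedgeZ 3 6 i j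

theorem cast_matEZ (i j : Fin 7) : (matEZ i j : ℝ) = matE i j := by
  simp [matEZ, matE, cast_wedgeZ]

/-- The integer entries of `basisM`. -/
def basisZ (i : Fin 4 × Fin 3) (r c : Fin 7) : ℤ :=
  ![![wedgeZ 0 1 r c, wedgeZ 0 2 r c, wedgeZ 0 3 r c],
    ![wedgeZ 0 4 r c, wedgeZ 0 5 r c, wedgeZ 0 6 r c],
    ![wedgeZ 2 3 r c - wedgeZ 5 6 r c, wedgeZ 3 1 r c - wedgeZ 6 4 r c,
      wedgeZ 1 2 r c - wedgeZ 4 5 r c],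
    ![wedgeZ 2 6 r c - wedgeZ 3 5 r c, wedgeZ 3 4 r c - wedgeZ 1 6 r c,
      wedgeZ 1 5 r c - wedgeZ 2 4 r c]] i.1 i.2

theorem cast_basisZ (i : Fin 4 × Fin 3) (r c : Fin 7) : (basisZ i r c : ℝ) = basisM i r c := by
  obtain ⟨i, k⟩ := i
  fin_cases i <;>
    simp only [Fin.zero_eta, Fin.mk_one, Fin.reduceFinMk, basisM_zero, basisM_one, basisM_two,
      basisM_three, Matrix.sub_apply, ← cast_wedgeZ] <;>
    fin_cases k <;> simp [basisZ]

theorem signedPerm_mem_U3 (π : Equiv.Perm (Fin 7)) (s : Fin 7 → ℤ) (h0 : π 0 = 0) (s0 : s 0 = 1)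
    (hE : ∀ i j, s i * matEZ i j = matEZ (π i) (π j) * s j) {a : SO7}
    (ha : (a : Mat) = signedPerm π s) : a ∈ U3 := by
  constructor
  · rw [ha, mulVec_single_one]
    ext i
    simp [signedPerm, h0, s0, Pi.single_apply]
  · rw [ha]
    ext i j
    obtain ⟨i, rfl⟩ := π.surjective i
    rw [signedPerm_mul_apply, mul_signedPerm_apply, ← cast_matEZ, ← cast_matEZ]
    exact_mod_cast hE i j

/-- Written without the inverse, the relation is an identity between integer entries and becomes
decidable. -/
theorem Ad_signedPerm_basisM (π : Equiv.Perm (Fin 7)) (s : Fin 7 → ℤ) {a : SO7}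
    (ha : (a : Mat) = signedPerm π s) {i j : Fin 4 × Fin 3} {e : ℤ}
    (h : ∀ r c, s r * basisZ i r c = e * basisZ j (π r) (π c) * s c) :
    Ad a (basisM i) = (e : ℝ) • basisM j := by
  have key : (a : Mat) * basisM i = (e : ℝ) • basisM j * (a : Mat) := by
    rw [ha]
    ext r c
    obtain ⟨r, rfl⟩ := π.surjective r
    rw [signedPerm_mul_apply, mul_signedPerm_apply, Matrix.smul_apply, smul_eq_mul, ← cast_basisZ,
      ← cast_basisZ]
    exact_mod_cast h r c
  change (a : Mat) * basisM i * ((a⁻¹ : SO7) : Mat) = _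
  rw [key, mul_assoc, coe_mul_coe_inv, mul_one]

/-- `diag(i, -i, 1)`. -/
def elT : U3 := ⟨⟨
  signedPerm (Equiv.swap 1 4 * Equiv.swap 2 5) ![1, 1, -1, 1, -1, 1, 1],
  signedPerm_mem _ _ (by decide) (by decide)⟩,
  signedPerm_mem_U3 _ _ (by decide) (by decide) (by decide) rfl⟩

/-- `diag(1, -1, -1)`. -/
def elD : U3 := ⟨⟨
  signedPerm 1 ![1, 1, -1, -1, 1, -1, -1],
  signedPerm_mem _ _ (by decide) (by decide)⟩,
  signedPerm_mem_U3 _ _ (by decide) (by decide) (by decide) rfl⟩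

/-- The cyclic permutation of the coordinates. -/
def elS : U3 := ⟨⟨
  signedPerm (Equiv.swap 1 2 * Equiv.swap 2 3 * (Equiv.swap 4 5 * Equiv.swap 5 6)) 1,
  signedPerm_mem _ _ (by decide) (by decide)⟩,
  signedPerm_mem_U3 _ _ (by decide) (by decide) (by decide) rfl⟩

/-- `diag(i, 1, 1)`. -/
def elW : U3 := ⟨⟨
  signedPerm (Equiv.swap 1 4) ![1, 1, 1, 1, -1, 1, 1],
  signedPerm_mem _ _ (by decide) (by decide)⟩,
  signedPerm_mem_U3 _ _ (by decide) (by decide) (by decide) rfl⟩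

/-- The rotation by a right angle in the first two complex coordinates. -/
def elR : U3 := ⟨⟨
  signedPerm (Equiv.swap 1 2 * Equiv.swap 4 5) ![1, 1, -1, 1, 1, -1, 1],
  signedPerm_mem _ _ (by decide) (by decide)⟩,
  signedPerm_mem_U3 _ _ (by decide) (by decide) (by decide) rfl⟩

/-- `-1` on `ℂ³`. -/
def elN : U3 := ⟨⟨
  signedPerm 1 ![1, -1, -1, -1, -1, -1, -1],
  signedPerm_mem _ _ (by decide) (by decide)⟩,
  signedPerm_mem_U3 _ _ (by decide) (by decide) (by decide) rfl⟩

theorem Ad_elT (i : Fin 4 × Fin 3) : Ad elT (basisM i) =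
    ((![![1, -1, 1], ![-1, 1, 1], ![-1, 1, 1], ![1, -1, 1]] i.1 i.2 : ℤ) : ℝ) •
      basisM (![![1, 1, 0], ![0, 0, 1], ![3, 3, 2], ![2, 2, 3]] i.1 i.2, i.2) :=
  Ad_signedPerm_basisM _ _ rfl (by revert i; decide)

theorem Ad_elS (i : Fin 4 × Fin 3) : Ad elS (basisM i) = basisM (i.1, i.2 + 1) := by
  have := Ad_signedPerm_basisM _ _ (a := elS) rfl (i := i) (j := (i.1, i.2 + 1)) (e := 1)
    (by revert i; decide)
  simpa using this

theorem Ad_elN (i : Fin 4 × Fin 3) : Ad elN (basisM i) =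
    ((![-1, -1, 1, 1] i.1 : ℤ) : ℝ) • basisM i :=
  Ad_signedPerm_basisM _ _ rfl (by revert i; decide)

/-! ### Relations among the chosen elements of `U(3)`. -/

theorem signedPerm_congr {π π' : Equiv.Perm (Fin 7)} {s s' : Fin 7 → ℤ} (h : π = π') (h' : s = s') :
    signedPerm π s = signedPerm π' s' := by rw [h, h']

/-- Solved for `elT`, this is `elR` times a conjugate of `elR`, so a normal subgroup containing
`elR` contains `elT`. The next relation does the same for `elS`. -/
theorem elT_mul_elW : elT * elW = elR * elW * elR := by
  refine Subtype.ext (Subtype.ext ?_)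
  change signedPerm _ _ * signedPerm _ _ = signedPerm _ _ * signedPerm _ _ * signedPerm _ _
  simp only [signedPerm_mul]
  exact signedPerm_congr (by decide) (by decide)

theorem elS_mul_elS : elS * elS = elR * elS * elR := by
  refine Subtype.ext (Subtype.ext ?_)
  change signedPerm _ _ * signedPerm _ _ = signedPerm _ _ * signedPerm _ _ * signedPerm _ _
  simp only [signedPerm_mul]
  exact signedPerm_congr (by decide) (by decide)

/-- Conjugation by `elS` takes `elT²` to `elD`, and by `elD_elT_elS` it takes `elD` to `elD * elT²`:
it permutes the involutions of a Klein four-group cyclically. -/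
theorem elD_mul_elS : elD * elS = elS * (elT * elT) := by
  refine Subtype.ext (Subtype.ext ?_)
  change signedPerm _ _ * signedPerm _ _ = signedPerm _ _ * (signedPerm _ _ * signedPerm _ _)
  simp only [signedPerm_mul]
  exact signedPerm_congr (by decide) (by decide)

theorem elT_mul_elD : elT * elD = elD * elT := by
  refine Subtype.ext (Subtype.ext ?_)
  change signedPerm _ _ * signedPerm _ _ = signedPerm _ _ * signedPerm _ _
  simp only [signedPerm_mul]
  exact signedPerm_congr (by decide) (by decide)

theorem elD_mul_elD : elD * elD = 1 := by
  refine Subtype.ext (Subtype.ext ?_)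
  change signedPerm _ _ * signedPerm _ _ = 1
  rw [signedPerm_mul]
  ext i j
  obtain ⟨h1, h2⟩ : (1 : Equiv.Perm (Fin 7)) * 1 = 1 ∧ (fun c => ![1, 1, -1, -1, 1, -1, -1]
      ((1 : Equiv.Perm (Fin 7)) c) * ![1, 1, -1, -1, 1, -1, -1] c : Fin 7 → ℤ) = 1 := by decide
  rw [h1, h2]
  simp [signedPerm, one_apply]

theorem elT_pow : elT * elT * (elT * elT) = 1 := by
  have h : elD = elS * (elT * elT) * elS⁻¹ := by rw [← elD_mul_elS, mul_inv_cancel_right]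
  have := elD_mul_elD
  rw [h] at this
  have e : elS * (elT * elT) * elS⁻¹ * (elS * (elT * elT) * elS⁻¹) =
      elS * (elT * elT * (elT * elT)) * elS⁻¹ := by group
  rwa [e, mul_inv_eq_one, mul_eq_left] at this

theorem elD_elT_elS : elD * (elT * elT) * elS = elS * elD := by
  refine Subtype.ext (Subtype.ext ?_)
  change signedPerm _ _ * (signedPerm _ _ * signedPerm _ _) * signedPerm _ _ =
    signedPerm _ _ * signedPerm _ _
  simp only [signedPerm_mul]
  exact signedPerm_congr (by decide) (by decide)

/-- The matrix of the rotation by `π / 4` in the first two complex coordinates when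
`c = √2 / 2`. -/
def rotMat (c : ℝ) : Mat :=
  !![1, 0, 0, 0, 0, 0, 0; 0, c, -c, 0, 0, 0, 0; 0, c, c, 0, 0, 0, 0; 0, 0, 0, 1, 0, 0, 0;
    0, 0, 0, 0, c, -c, 0; 0, 0, 0, 0, c, c, 0; 0, 0, 0, 0, 0, 0, 1]

theorem rotMat_mem {c : ℝ} (hc : c * c + c * c = 1) :
    rotMat c ∈ specialOrthogonalGroup (Fin 7) ℝ := by
  rw [mem_specialOrthogonalGroup_iff]
  constructor
  · rw [mem_orthogonalGroup_iff']
    ext r c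
    rw [Matrix.mul_apply]
    fin_cases r <;> fin_cases c <;>
      simp [rotMat, Fin.sum_univ_succ, hc]
  · have : (rotMat c).det = (c * c + c * c) * (c * c + c * c) := by
      simp [rotMat, det_succ_row_zero, Fin.sum_univ_succ, Fin.succAbove]
      ring
    rw [this, hc, one_mul]

theorem rotMat_mul_matE (c : ℝ) : rotMat c * matE = matE * rotMat c := by
  ext i j
  simp only [matE, mul_add, add_mul, Matrix.add_apply, mul_wedge_apply, wedge_mul_apply]
  fin_cases i <;> fin_cases j <;> simp [rotMat]

theorem half_sqrt_two_mul_self : √2 / 2 * (√2 / 2) + √2 / 2 * (√2 / 2) = (1 : ℝ) := by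
  have := Real.mul_self_sqrt (show (0 : ℝ) ≤ 2 by norm_num)
  linarith

/-- The rotation by `π / 4` in the first two complex coordinates. -/
def elH : U3 := ⟨⟨rotMat (√2 / 2), rotMat_mem half_sqrt_two_mul_self⟩, by
  refine ⟨?_, rotMat_mul_matE _⟩
  rw [mulVec_single_one]
  ext i
  fin_cases i <;> simp [rotMat]⟩

/-- This exhibits `elR` as a commutator of `elD` and `elH`. -/
theorem elD_mul_elH : elD * elH = elH * elD * elR := by
  refine Subtype.ext (Subtype.ext ?_)
  change signedPerm 1 ![1, 1, -1, -1, 1, -1, -1] * rotMat _ = rotMat _ * signedPerm 1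
    ![1, 1, -1, -1, 1, -1, -1] *
    signedPerm (Equiv.swap 1 2 * Equiv.swap 4 5) ![1, 1, -1, 1, 1, -1, 1]
  rw [mul_assoc, signedPerm_mul]
  ext i j
  rw [mul_signedPerm_apply]
  have e : ∀ j, (1 * (Equiv.swap 1 2 * Equiv.swap 4 5) : Equiv.Perm (Fin 7)) j =
    ![0, 2, 1, 3, 5, 4, 6] j := by decide
  have e' : ∀ j, (Equiv.swap 1 2 * Equiv.swap 4 5 : Equiv.Perm (Fin 7)) j =
    ![0, 2, 1, 3, 5, 4, 6] j := by decide
  refine (signedPerm_mul_apply 1 _ _ i j).trans ?_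
  rw [e, e']
  fin_cases i <;> fin_cases j <;> simp [rotMat]

/-! ### Three-dimensional representations -/

/-- The eigenvalues ±1 of `e` separate the first pair from the second. Inside a pair, `t² = -1` on
`y` acts as a complex structure, so `y` and `t y` are independent. -/
theorem linearIndependent_of_involution {V : Type*} [AddCommGroup V] [Module ℝ V]
    {e t s : Module.End ℝ V} {y : V} (hy : y ≠ 0) (hs : Function.Injective s)
    (htt : t (t y) = -y) (h0 : e y = y) (h1 : e (t y) = t y) (h2 : e (s y) = -s y)
    (h3 : e (s (t y)) = -s (t y)) : LinearIndependent ℝ ![y, t y, s y, s (t y)] := by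
  have key : ∀ a b : ℝ, a • y + b • t y = 0 → a = 0 ∧ b = 0 := fun a b h => by
    have h' := congrArg t h
    rw [map_add, map_smul, map_smul, htt, map_zero] at h'
    have : (a * a + b * b) • y = 0 := by
      calc (a * a + b * b) • y = a • (a • y + b • t y) - b • (a • t y + b • -y) := by module
        _ = 0 := by rw [h, h', smul_zero, smul_zero, sub_zero]
    have := (smul_eq_zero.1 this).resolve_right hy
    constructor <;> nlinarith
  rw [Fintype.linearIndependent_iff]
  intro c hc
  simp only [Fin.sum_univ_four] at hc
  have hc : c 0 • y + c 1 • t y + c 2 • s y + c 3 • s (t y) = 0 := hc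
  have hc' := congrArg e hc
  simp only [map_add, map_smul, h0, h1, h2, h3, map_zero] at hc'
  have e1 : c 0 • y + c 1 • t y = 0 := by
    have : (2 : ℝ) • (c 0 • y + c 1 • t y) = 0 := by
      calc _ = (c 0 • y + c 1 • t y + c 2 • s y + c 3 • s (t y)) +
            (c 0 • y + c 1 • t y + c 2 • -s y + c 3 • -s (t y)) := by module
        _ = 0 := by rw [hc, hc', add_zero]
    exact (smul_eq_zero.1 this).resolve_left two_ne_zero
  have e2 : c 2 • y + c 3 • t y = 0 := by
    apply hs
    rw [map_add, map_smul, map_smul, map_zero]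
    rwa [e1, zero_add] at hc
  obtain ⟨k0, k1⟩ := key _ _ e1
  obtain ⟨k2, k3⟩ := key _ _ e2
  intro i
  fin_cases i <;> assumption

/-- The subgroup of the elements that act trivially on an invariant subspace. -/
def fixer {H V : Type*} [Group H] [AddCommMonoid V] [Module ℝ V]
    (ρ : H →* Module.End ℝ V) (G : Submodule ℝ V) : Subgroup H where
  carrier := {h | ∀ x ∈ G, ρ h x = x}
  one_mem' x _ := by rw [map_one, Module.End.one_apply]
  mul_mem' {a b} ha hb x hx := by rw [map_mul, Module.End.mul_apply, hb x hx, ha x hx]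
  inv_mem' {a} ha x hx := by
    conv_lhs => rw [← ha x hx]
    rw [← Module.End.mul_apply, ← map_mul, inv_mul_cancel, map_one, Module.End.one_apply]

theorem conj_mem_fixer {H V : Type*} [Group H] [AddCommMonoid V] [Module ℝ V]
    {ρ : H →* Module.End ℝ V} {G : Submodule ℝ V}
    (hG : ∀ h, ∀ x ∈ G, ρ h x ∈ G) {n : H} (hn : n ∈ fixer ρ G) (h : H) :
    h * n * h⁻¹ ∈ fixer ρ G := fun x hx => by
  rw [map_mul, map_mul, Module.End.mul_apply, Module.End.mul_apply, hn _ (hG _ x hx),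
    ← Module.End.mul_apply, ← map_mul, mul_inv_cancel, map_one, Module.End.one_apply]

/-- If `t²` had eigenvalue -1 on `G`, some eigenvector `y` common to `d` and `t²` would give with
its images `t y`, `s y`, `s t y` four independent vectors, too many for dimension three. -/
theorem sq_mem_fixer {H V : Type*} [Group H] [AddCommGroup V] [Module ℝ V]
    {ρ : H →* Module.End ℝ V} {G : Submodule ℝ V} [FiniteDimensional ℝ G]
    (hfin : Module.finrank ℝ G ≤ 3) (hG : ∀ h, ∀ x ∈ G, ρ h x ∈ G) {t s d : H}
    (hsd : d * s = s * (t * t)) (htd : t * d = d * t) (hdd : d * d = 1)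
    (ht : t * t * (t * t) = 1) (hds : d * (t * t) * s = s * d) : t * t ∈ fixer ρ G := by
  have act : ∀ (a b : H) (x : V), ρ a (ρ b x) = ρ (a * b) x := fun a b x => by
    rw [map_mul, Module.End.mul_apply]
  have inj : ∀ a : H, Function.Injective (ρ a) := fun a x y h => by
    have := congrArg (ρ a⁻¹) h
    rwa [act, act, inv_mul_cancel, map_one] at this
  -- Here `e` is `d` or `d t²`, whose conjugates by `s⁻¹` are `t²` and `d`. It fixes the plane of
  -- `y`, `t y` and is -1 on the image of that plane under `s`.
  have core : ∀ e : H, e * s = s * (t * t) ∨ e * s = s * d → e * t = t * e →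
      ∀ y ∈ G, ρ (t * t) y = -y → ρ e y = y → ρ (s⁻¹ * e * s) y = -y → y = 0 := by
    intro e he het y hy h3 h0 h1
    by_contra hne
    have hli : LinearIndependent ℝ ![y, ρ t y, ρ s y, ρ s (ρ t y)] := by
      have hc : s⁻¹ * e * s * t = t * (s⁻¹ * e * s) := by
        rcases he with he | he
        · rw [mul_assoc s⁻¹, he, inv_mul_cancel_left, mul_assoc]
        · rw [mul_assoc s⁻¹, he, inv_mul_cancel_left, htd]
      refine linearIndependent_of_involution (e := ρ e) hne (inj s) ?_ h0 ?_ ?_ ?_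
      · rw [act, h3]
      · rw [act, het, ← act, h0]
      · rw [act, show e * s = s * (s⁻¹ * e * s) by group, ← act, h1, map_neg]
      · rw [act, act, show e * s * t = s * (s⁻¹ * e * s * t) by group, hc, ← act, ← act, h1,
          map_neg, map_neg]
    have hli' : LinearIndependent ℝ
        ![(⟨y, hy⟩ : G), ⟨ρ t y, hG _ _ hy⟩, ⟨ρ s y, hG _ _ hy⟩,
          ⟨ρ s (ρ t y), hG _ _ (hG _ _ hy)⟩] := by
      apply LinearIndependent.of_comp G.subtype
      convert hli using 1
      ext i
      fin_cases i <;> rfl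
    have := hli'.fintype_card_le_finrank
    rw [Fintype.card_fin] at this
    omega
  have htt : ∀ x, ρ (t * t) (ρ (t * t) x) = x := fun x => by
    rw [act, ht, map_one, Module.End.one_apply]
  have hd2 : ∀ x, ρ d (ρ d x) = x := fun x => by
    rw [act, hdd, map_one, Module.End.one_apply]
  have hcomm : d * (t * t) = t * t * d := by
    rw [mul_assoc t, htd, ← mul_assoc, ← mul_assoc, htd]
  have hdt : ∀ x, ρ (t * t) (ρ d x) = ρ d (ρ (t * t) x) := fun x => by rw [act, act, hcomm]
  have hz : ∀ y ∈ G, ρ (t * t) y = -y → y = 0 := by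
    intro y hy h3
    -- The two eigencomponents of `y` under `d` are excluded separately: `e = d` for the value +1,
    -- and `e = d t²` for the value -1.
    have p1 : y + ρ d y = 0 := by
      refine core d (Or.inl hsd) htd.symm _ (add_mem hy (hG _ _ hy)) ?_ ?_ ?_
      · rw [map_add, hdt, h3, map_neg, neg_add]
      · rw [map_add, hd2, add_comm]
      · rw [mul_assoc, hsd, inv_mul_cancel_left, map_add, hdt, h3, map_neg, neg_add]
    have p2 : y - ρ d y = 0 := by
      have q3 : ρ (t * t) (y - ρ d y) = -(y - ρ d y) := by
        rw [map_sub, hdt, h3, map_neg]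
        abel
      have q1 : ρ d (y - ρ d y) = -(y - ρ d y) := by
        rw [map_sub, hd2, neg_sub]
      refine core (d * (t * t)) (Or.inr hds) ?_ _ (sub_mem hy (hG _ _ hy)) q3 ?_ ?_
      · rw [hcomm, mul_assoc, ← htd]
        simp only [mul_assoc]
      · rw [← act, q3, map_neg, q1, neg_neg]
      · rw [mul_assoc, hds, inv_mul_cancel_left, q1]
    have : (2 : ℝ) • y = 0 := by
      calc (2 : ℝ) • y = (y + ρ d y) + (y - ρ d y) := by module
        _ = 0 := by rw [p1, p2, add_zero]
    exact (smul_eq_zero.1 this).resolve_left two_ne_zero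
  intro x hx
  have := hz (x - ρ (t * t) x) (sub_mem hx (hG _ _ hx)) (by rw [map_sub, htt, neg_sub])
  exact (sub_eq_zero.1 this).symm

/-- The fixer of an invariant subspace is normal. From `elT²` it acquires the conjugate `elD`, then
the commutator `elR`, then `elT` and `elS` as products of conjugates of `elR`. -/
theorem mem_fixer_of_finrank {V : Type*} [AddCommGroup V] [Module ℝ V]
    {ρ : U3 →* Module.End ℝ V} {G : Submodule ℝ V} [FiniteDimensional ℝ G]
    (hfin : Module.finrank ℝ G ≤ 3) (hG : ∀ h, ∀ x ∈ G, ρ h x ∈ G) :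
    elT ∈ fixer ρ G ∧ elS ∈ fixer ρ G := by
  have hT := sq_mem_fixer hfin hG elD_mul_elS elT_mul_elD elD_mul_elD elT_pow elD_elT_elS
  have hD : elD ∈ fixer ρ G := by
    have := conj_mem_fixer hG hT elS
    rwa [← elD_mul_elS, mul_inv_cancel_right] at this
  have hR : elR ∈ fixer ρ G := by
    have e : elR = elD⁻¹ * (elH⁻¹ * elD * (elH⁻¹)⁻¹) := by
      rw [inv_inv, mul_assoc, elD_mul_elH]
      group
    rw [e]
    exact mul_mem (inv_mem hD) (conj_mem_fixer hG hD _)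
  constructor
  · rw [eq_mul_inv_of_mul_eq elT_mul_elW, mul_assoc, mul_assoc, ← mul_assoc elW]
    exact mul_mem hR (conj_mem_fixer hG hR _)
  · rw [eq_mul_inv_of_mul_eq elS_mul_elS, mul_assoc, mul_assoc, ← mul_assoc elS]
    exact mul_mem hR (conj_mem_fixer hG hR _)

/-! ### The isotropy representation -/

theorem smul_base (h : U3) : (h : SO7) • ((1 : SO7) : M) = ((1 : SO7) : M) :=
  (QuotientGroup.eq.2 (by simp)).symm

theorem Ad_mem_base (h : U3) {X : Mat} (hX : X ∈ T ((1 : SO7) : M)) :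
    Ad h X ∈ T ((1 : SO7) : M) :=
  smul_base h ▸ Ad_mem_tangent_smul h hX

/-- The isotropy representation of `U(3)` on the tangent space at the base point. -/
def isotropy : U3 →* Module.End ℝ (T ((1 : SO7) : M)) where
  toFun h := (Ad h).restrict fun _ => Ad_mem_base h
  map_one' := by
    ext X : 2
    exact Ad_one _
  map_mul' a b := by
    ext X : 2
    exact Ad_mul _ _ _

theorem coe_isotropy (h : U3) (X : T ((1 : SO7) : M)) : (isotropy h X : Mat) = Ad h X := rfl

/-- The action of `U(3)` by conjugation on the endomorphisms of the tangent space at the base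
point. -/
def isotropyConj : U3 →* Module.End ℝ (Module.End ℝ (T ((1 : SO7) : M))) where
  toFun h := LinearMap.mulLeft ℝ (isotropy h) * LinearMap.mulRight ℝ (isotropy h⁻¹)
  map_one' := by
    ext Z : 1
    simp
  map_mul' a b := by
    ext Z : 1
    simp [mul_assoc]

theorem isotropyConj_apply (h : U3) (Z : Module.End ℝ (T ((1 : SO7) : M))) :
    isotropyConj h Z = isotropy h * Z * isotropy h⁻¹ := by
  simp [isotropyConj, mul_assoc]

/-- An element of `U(3)` fixes the base point only up to a propositional equality, so tangent
vectors at the two points are compared through their matrices. -/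
theorem RiemMetric.inner_congr (g : RiemMetric) {m m' : M} (e : m' = m) {X Y : T m'} {X' Y' : T m}
    (hX : (X : Mat) = X') (hY : (Y : Mat) = Y') : g.inner m' X Y = g.inner m X' Y' := by
  subst e
  rw [Subtype.ext hX, Subtype.ext hY]

theorem AQHStructure.mem_congr (Q : AQHStructure) {m m' : M} (e : m' = m)
    {Z : Module.End ℝ (T m')} {Z' : Module.End ℝ (T m)}
    (h : ∀ (X : T m') (X' : T m), (X : Mat) = X' → (Z X : Mat) = Z' X') (hZ : Z ∈ Q.G m') :
    Z' ∈ Q.G m := by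
  subst e
  have : Z = Z' := by
    ext X : 2
    exact h X X rfl
  rwa [← this]

theorem RiemMetric.IsInvariant.inner_isotropy {g : RiemMetric} (hg : g.IsInvariant) (h : U3)
    (X Y : T ((1 : SO7) : M)) : g.inner _ (isotropy h X) (isotropy h Y) = g.inner _ X Y := by
  rw [← hg h _ X Y]
  exact (g.inner_congr (smul_base h) rfl rfl).symm

theorem AQHStructure.IsInvariant.isotropyConj_mem {Q : AQHStructure} (hQ : Q.IsInvariant) (h : U3)
    (Z : Module.End ℝ (T ((1 : SO7) : M))) (hZ : Z ∈ Q.G ((1 : SO7) : M)) :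
    isotropyConj h Z ∈ Q.G ((1 : SO7) : M) := by
  have h1 : (push h ((1 : SO7) : M)).conj Z ∈ Q.G ((h : SO7) • ((1 : SO7) : M)) := by
    rw [← hQ.2]
    exact Submodule.mem_map_of_mem hZ
  refine Q.mem_congr (smul_base h) (fun X X' e => ?_) h1
  rw [isotropyConj_apply]
  change Ad h (Z ⟨Ad h⁻¹ X, _⟩) = Ad h (Z ⟨Ad h⁻¹ X', _⟩)
  simp only [e]

theorem coe_frame_one (i : Fin 4 × Fin 3) : (frame 1 i : Mat) = basisM i := Ad_one _

theorem isotropy_frame {h : U3} {i j : Fin 4 × Fin 3} {c : ℝ}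
    (e : Ad h (basisM i) = c • basisM j) : isotropy h (frame 1 i) = c • frame 1 j := by
  apply Subtype.ext
  rw [coe_isotropy, Submodule.coe_smul, coe_frame_one, coe_frame_one, e]

/-- The sign in the action of `diag(i, -i, 1)` on the frame. -/
def signT (i : Fin 4 × Fin 3) : ℤ :=
  ![![1, -1, 1], ![-1, 1, 1], ![-1, 1, 1], ![1, -1, 1]] i.1 i.2

/-- The permutation in the action of `diag(i, -i, 1)` on the frame. -/
def permT (i : Fin 4 × Fin 3) : Fin 4 × Fin 3 :=
  (![![1, 1, 0], ![0, 0, 1], ![3, 3, 2], ![2, 2, 3]] i.1 i.2, i.2)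

theorem isotropy_elT (i : Fin 4 × Fin 3) :
    isotropy elT (frame 1 i) = (signT i : ℝ) • frame 1 (permT i) :=
  isotropy_frame (Ad_elT i)

theorem isotropy_elS (i : Fin 4 × Fin 3) :
    isotropy elS (frame 1 i) = (1 : ℝ) • frame 1 (i.1, i.2 + 1) :=
  isotropy_frame ((Ad_elS i).trans (one_smul _ _).symm)

theorem isotropy_elN (i : Fin 4 × Fin 3) :
    isotropy elN (frame 1 i) = ((![-1, -1, 1, 1] i.1 : ℤ) : ℝ) • frame 1 i :=
  isotropy_frame (Ad_elN i)

theorem permT_permT (i : Fin 4 × Fin 3) : permT (permT i) = i := by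
  revert i
  decide

/-- The sign in the action of `diag(-1, -1, 1)` on the frame. -/
theorem signT_mul_signT (i : Fin 4 × Fin 3) :
    signT i * signT (permT i) = if i.2 = 2 then 1 else -1 := by
  revert i
  decide

theorem signT_mul_self (i : Fin 4 × Fin 3) : signT i * signT i = 1 := by
  revert i
  decide

/-- If two distinct indices both differ from 2, they are 0 and 1, and the cyclic shift brings
exactly one of them to 2. -/
theorem eq_zero_of_shift {x : Fin 4 × Fin 3 → Fin 4 × Fin 3 → ℝ}
    (hS : ∀ i j k l, x (i, k + 1) (j, l + 1) = x (i, k) (j, l))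
    (h2 : ∀ i j k l, (k = 2 ↔ l ≠ 2) → x (i, k) (j, l) = 0) (i j : Fin 4) {k l : Fin 3}
    (h : k ≠ l) : x (i, k) (j, l) = 0 := by
  by_cases hk : k = 2 ↔ l ≠ 2
  · exact h2 i j k l hk
  · rw [← hS]
    by_cases hk' : k + 1 = 2 ↔ l + 1 ≠ 2
    · exact h2 _ _ _ _ hk'
    · have : ∀ k l : Fin 3, k ≠ l → ¬(k = 2 ↔ l ≠ 2) → (k + 1 = 2 ↔ l + 1 ≠ 2) := by decide
      exact absurd (this k l h hk) hk'

theorem eq_of_shift {x : Fin 4 × Fin 3 → Fin 4 × Fin 3 → ℝ}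
    (hS : ∀ i j k l, x (i, k + 1) (j, l + 1) = x (i, k) (j, l)) (i j : Fin 4) (k : Fin 3) :
    x (i, k) (j, k) = x (i, 0) (j, 0) := by
  have h1 : x (i, 1) (j, 1) = x (i, 0) (j, 0) := hS i j 0 0
  have h2 : x (i, 2) (j, 2) = x (i, 1) (j, 1) := hS i j 1 1
  fin_cases k
  · rfl
  · exact h1
  · exact h2.trans h1

/-! ### Invariant metrics -/

/-- Applying `elT` twice gives diag(-1, -1, 1), whose signs differ when exactly one of the indices
is 2. -/
theorem eq_zero_of_signT {x : Fin 4 × Fin 3 → Fin 4 × Fin 3 → ℝ}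
    (hT : ∀ i j, (signT j * (signT i * x (permT i) (permT j)) : ℝ) = x i j)
    (i j : Fin 4) (k l : Fin 3) (hkl : k = 2 ↔ l ≠ 2) : x (i, k) (j, l) = 0 := by
  have e := hT (i, k) (j, l)
  rw [← hT (permT (i, k)), permT_permT, permT_permT] at e
  have s1 := signT_mul_signT (i, k)
  have s2 := signT_mul_signT (j, l)
  have e' : ((signT (i, k) * signT (permT (i, k)) * (signT (j, l) * signT (permT (j, l))) : ℤ) :
      ℝ) * x (i, k) (j, l) = x (i, k) (j, l) := by
    push_cast
    linarith
  have h1 : (signT (i, k) * signT (permT (i, k)) * (signT (j, l) * signT (permT (j, l)))) = -1 := by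
    rw [s1, s2]
    by_cases hk : k = 2
    · rw [if_pos hk, if_neg (hkl.1 hk), one_mul]
    · rw [if_neg hk, if_pos (not_ne_iff.1 fun h => hk (hkl.2 h)), mul_one]
  rw [h1] at e'
  push_cast at e'
  linarith

/-- Blocks with different complex coordinates vanish by `elT` and `elS`. Inside a block, `elT` is a
quarter turn on each of the two planes, which makes a symmetric form a multiple of the standard one
there. The element `elN` has opposite signs on the planes and removes the mixed terms. -/
theorem eq_ite_of_signs {x : Fin 4 × Fin 3 → Fin 4 × Fin 3 → ℝ} (hsymm : ∀ i j, x i j = x j i)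
    (hS : ∀ i j k l, x (i, k + 1) (j, l + 1) = x (i, k) (j, l))
    (hT : ∀ i j, (signT j * (signT i * x (permT i) (permT j)) : ℝ) = x i j)
    (hN : ∀ i j, ((![-1, -1, 1, 1] j.1 : ℤ) : ℝ) * (((![-1, -1, 1, 1] i.1 : ℤ) : ℝ) * x i j) =
      x i j) (i j : Fin 4 × Fin 3) :
    x i j = if i = j then wt (x (0, 0) (0, 0)) (x (2, 0) (2, 0)) i.1 else 0 := by
  obtain ⟨i, k⟩ := i
  obtain ⟨j, l⟩ := j
  by_cases hkl : k = l
  · subst hkl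
    rw [eq_of_shift hS]
    have t00 := hT (0, 0) (0, 0)
    have t01 := hT (0, 0) (1, 0)
    have t22 := hT (2, 0) (2, 0)
    have t23 := hT (2, 0) (3, 0)
    have n02 := hN (0, 0) (2, 0)
    have n03 := hN (0, 0) (3, 0)
    have n12 := hN (1, 0) (2, 0)
    have n13 := hN (1, 0) (3, 0)
    have s01 := hsymm (0, 0) (1, 0)
    have s02 := hsymm (0, 0) (2, 0)
    have s03 := hsymm (0, 0) (3, 0)
    have s12 := hsymm (1, 0) (2, 0)
    have s13 := hsymm (1, 0) (3, 0)
    have s23 := hsymm (2, 0) (3, 0)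
    simp [signT, permT] at t00 t01 t22 t23 n02 n03 n12 n13
    fin_cases i <;> fin_cases j <;> simp [wt] <;> linarith
  · rw [eq_zero_of_shift hS (eq_zero_of_signT hT) i j hkl, if_neg fun e => hkl (Prod.ext_iff.1 e).2]

theorem RiemMetric.IsInvariant.inner_frame {g : RiemMetric} (hg : g.IsInvariant)
    (i j : Fin 4 × Fin 3) : g.inner _ (frame 1 i) (frame 1 j) =
      if i = j then wt (g.inner _ (frame 1 (0, 0)) (frame 1 (0, 0)))
        (g.inner _ (frame 1 (2, 0)) (frame 1 (2, 0))) i.1 else 0 := by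
  refine eq_ite_of_signs (x := fun i j => g.inner _ (frame 1 i) (frame 1 j))
    (fun i j => g.symm _ _ _) (fun i j k l => ?_) (fun i j => ?_) (fun i j => ?_) i j
  · have := hg.inner_isotropy elS (frame 1 (i, k)) (frame 1 (j, l))
    rwa [isotropy_elS, isotropy_elS, one_smul, one_smul] at this
  · have := hg.inner_isotropy elT (frame 1 i) (frame 1 j)
    rwa [isotropy_elT, isotropy_elT, map_smul, map_smul, LinearMap.smul_apply, smul_eq_mul,
      smul_eq_mul] at this
  · have := hg.inner_isotropy elN (frame 1 i) (frame 1 j)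
    rwa [isotropy_elN, isotropy_elN, map_smul, map_smul, LinearMap.smul_apply, smul_eq_mul,
      smul_eq_mul] at this

theorem RiemMetric.IsInvariant.isStandard {g : RiemMetric} (hg : g.IsInvariant) :
    g.IsStandard (g.inner _ (frame 1 (0, 0)) (frame 1 (0, 0)))
      (g.inner _ (frame 1 (2, 0)) (frame 1 (2, 0))) := by
  set lam := g.inner _ (frame 1 (0, 0)) (frame 1 (0, 0))
  set mu := g.inner _ (frame 1 (2, 0)) (frame 1 (2, 0))
  have base : ∀ X Y : T ((1 : SO7) : M), g.inner _ X Y = metricForm lam mu X Y := by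
    have : g.inner ((1 : SO7) : M) =
        (metricBilin lam mu).compl₁₂ (T _).subtype (T _).subtype := by
      refine LinearMap.BilinForm.ext_basis (frameBasis 1) fun i j => ?_
      rw [frameBasis_apply, frameBasis_apply, hg.inner_frame]
      change _ = metricForm lam mu (frame 1 i) (frame 1 j)
      rw [coe_frame_one, coe_frame_one, metricForm_basisM]
    intro X Y
    rw [this]
    rfl
  intro a X Y
  have e : a • ((1 : SO7) : M) = a := congrArg QuotientGroup.mk (mul_one a)
  let X' : T (a • ((1 : SO7) : M)) := ⟨X, e.symm ▸ X.2⟩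
  let Y' : T (a • ((1 : SO7) : M)) := ⟨Y, e.symm ▸ Y.2⟩
  rw [← g.inner_congr e (X := X') (Y := Y') rfl rfl]
  have := hg a _ ((push a _).symm X') ((push a _).symm Y')
  rw [LinearEquiv.apply_symm_apply, LinearEquiv.apply_symm_apply, base] at this
  exact this

theorem RiemMetric.isInvariant_and_isNormalised_iff (g : RiemMetric) :
    g.IsInvariant ∧ g.IsNormalised ↔
      ∃ lam mu : ℝ, 0 < lam ∧ 0 < mu ∧ lam * mu = 1 ∧ g.IsStandard lam mu := by
  constructor
  · rintro ⟨hg, hn⟩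
    have h := hg.isStandard
    exact ⟨_, _, h.pos_left, h.pos_right, h.isNormalised_iff.1 hn, h⟩
  · rintro ⟨lam, mu, -, -, hlm, h⟩
    exact ⟨h.isInvariant, h.isNormalised_iff.2 hlm⟩

/-! ### Invariant quaternionic structures -/

/-- The entries of an endomorphism of the tangent space at the base point in the frame. -/
def entry (Z : Module.End ℝ (T ((1 : SO7) : M))) (i j : Fin 4 × Fin 3) : ℝ :=
  (frameBasis 1).repr (Z (frame 1 j)) i

theorem entry_frame_permute {A Z : Module.End ℝ (T ((1 : SO7) : M))} (hAZ : A * Z = Z * A)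
    {c : Fin 4 × Fin 3 → ℝ} {τ : Fin 4 × Fin 3 → Fin 4 × Fin 3} (hτ : Function.Injective τ)
    (hA : ∀ i, A (frame 1 i) = c i • frame 1 (τ i)) (i j : Fin 4 × Fin 3) :
    c i * entry Z i j = c j * entry Z (τ i) (τ j) := by
  have h1 : ∀ v, (frameBasis 1).repr (A v) (τ i) = c i * (frameBasis 1).repr v i := fun v => by
    have : (frameBasis 1).coord (τ i) ∘ₗ A = c i • (frameBasis 1).coord i := by
      refine (frameBasis 1).ext fun k => ?_
      rw [LinearMap.comp_apply, frameBasis_apply, hA, map_smul, LinearMap.smul_apply,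
        ← frameBasis_apply, ← frameBasis_apply, Module.Basis.coord_apply, Module.Basis.coord_apply,
        Module.Basis.repr_self, Module.Basis.repr_self, Finsupp.single_apply, Finsupp.single_apply,
        smul_eq_mul, smul_eq_mul]
      by_cases h : k = i
      · rw [h, if_pos rfl, if_pos rfl]
      · rw [if_neg h, if_neg (hτ.ne h), mul_zero, mul_zero]
    exact LinearMap.congr_fun this v
  rw [entry, ← h1, ← Module.End.mul_apply, hAZ, Module.End.mul_apply, hA, map_smul, map_smul,
    Finsupp.smul_apply, smul_eq_mul, entry]

theorem commute_of_isotropyConj {h : U3} {Z : Module.End ℝ (T ((1 : SO7) : M))}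
    (e : isotropyConj h Z = Z) : isotropy h * Z = Z * isotropy h := by
  have hh : isotropy h⁻¹ * isotropy h = 1 := by rw [← map_mul, inv_mul_cancel, map_one]
  conv_rhs => rw [← e, isotropyConj_apply, mul_assoc, hh, mul_one]

/-- Commuting with `elT²` and the cyclic shift makes `Z` block diagonal with three equal 4 × 4
blocks. -/
theorem eq_endAt_of_commute {Z : Module.End ℝ (T ((1 : SO7) : M))}
    (hT : isotropy elT * Z = Z * isotropy elT) (hS : isotropy elS * Z = Z * isotropy elS) :
    Z = endAt 1 rfl (of fun i j => entry Z (i, 0) (j, 0)) := by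
  have eS : ∀ i j k l, entry Z (i, k + 1) (j, l + 1) = entry Z (i, k) (j, l) := fun i j k l => by
    have := entry_frame_permute hS (c := fun _ => 1) (τ := fun i => (i.1, i.2 + 1))
      (fun a b h => by simpa [Prod.ext_iff] using h) isotropy_elS (i, k) (j, l)
    rw [one_mul, one_mul] at this
    exact this.symm
  have eT : ∀ i j, (signT j * (signT i * entry Z (permT i) (permT j)) : ℝ) = entry Z i j :=
    fun i j => by
      have := entry_frame_permute hT (Function.LeftInverse.injective permT_permT) isotropy_elT i j
      rw [mul_left_comm, ← this, ← mul_assoc]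
      have s : (signT i * signT i : ℝ) = 1 := by exact_mod_cast signT_mul_self i
      rw [s, one_mul]
  refine (frameBasis 1).ext fun j => tangent_ext fun i => ?_
  rw [frameBasis_apply, coe_endAt, coM_stdOp, Ad_inv_frame]
  change entry Z i j = _
  obtain ⟨i, k⟩ := i
  obtain ⟨j, l⟩ := j
  simp only [coM_basisM, of_apply, Prod.mk.injEq, mul_ite, mul_one, mul_zero]
  by_cases h : k = l
  · subst h
    simp [eq_of_shift eS]
  · simp [h, eq_zero_of_shift eS (eq_zero_of_signT eT) i j h]

/-- The central element of the commutant of `SU(3)`. -/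
def matZ : Matrix (Fin 4) (Fin 4) ℝ := !![0, -1, 0, 0; 1, 0, 0, 0; 0, 0, 0, 1; 0, 0, -1, 0]

theorem eq_of_skew_of_commute {lam mu : ℝ} (hl : 0 < lam) (hm : 0 < mu) (hlm : lam * mu = 1)
    {L : Matrix (Fin 4) (Fin 4) ℝ} (hZ : matZ * L = L * matZ)
    (hs : ∀ i j, wt lam mu i * L i j = -(wt lam mu j * L j i)) :
    ∃ (s w : ℝ) (z : ℂ), L = s • matI + w • matZ + matJ lam mu z := by
  have e := fun i j => congrFun (congrFun hZ i) j
  have e02 := e 0 2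
  have e03 := e 0 3
  have e12 := e 1 2
  have e20 := e 2 0
  have e21 := e 2 1
  simp [matZ, Matrix.mul_apply, Fin.sum_univ_four] at e02 e03 e12 e20 e21
  have d : ∀ i, L i i = 0 := fun i => by
    have := hs i i
    have hw := (wt_pos hl hm i).ne'
    have : wt lam mu i * L i i = 0 := by linarith
    exact (mul_eq_zero.1 this).resolve_left hw
  have s01 := hs 0 1
  have s23 := hs 2 3
  have s02 := hs 0 2
  have s03 := hs 0 3
  simp [wt] at s01 s23 s02 s03
  have s01' : L 0 1 = -L 1 0 := mul_left_cancel₀ hl.ne' (by linarith)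
  have s23' : L 2 3 = -L 3 2 := mul_left_cancel₀ hm.ne' (by linarith)
  have s02' : L 0 2 = -(mu * mu * L 2 0) := by
    calc L 0 2 = lam * mu * L 0 2 := by rw [hlm, one_mul]
      _ = mu * (lam * L 0 2) := by ring
      _ = _ := by rw [s02]; ring
  have s03' : L 0 3 = -(mu * mu * L 2 1) := by
    calc L 0 3 = lam * mu * L 0 3 := by rw [hlm, one_mul]
      _ = mu * (lam * L 0 3) := by ring
      _ = _ := by rw [s03, e20]; ring
  have c : ∀ x, lam * (mu * x) = x := fun x => by rw [← mul_assoc, hlm, one_mul]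
  -- `matI` and `matZ` agree on the first plane and are opposite on the second, whence the half sum
  -- and half difference. The factor `mu` in `z` cancels the `lam` in the lower left block of
  -- `matJ`.
  refine ⟨(L 1 0 + L 3 2) / 2, (L 1 0 - L 3 2) / 2, ⟨mu * L 2 0, -(mu * L 2 1)⟩, ?_⟩
  ext i j
  fin_cases i <;> fin_cases j <;> simp [matI, matZ, matJ, d, s01', s23', c] <;> linarith

theorem matJ_mul_matJ_sub {lam mu : ℝ} (hlm : lam * mu = 1) (z w : ℂ) :
    matJ lam mu z * matJ lam mu w - matJ lam mu w * matJ lam mu z =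
      (2 * (z.im * w.re - z.re * w.im)) • matI := by
  ext i j
  fin_cases i <;> fin_cases j <;> simp [matI, matJ]
  all_goals first
    | ring1
    | linear_combination (2 * (z.im * w.re - z.re * w.im)) * hlm
    | linear_combination -(2 * (z.im * w.re - z.re * w.im)) * hlm

theorem matI_mul_matZ : matI * matZ = matZ * matI := by
  ext i j
  fin_cases i <;> fin_cases j <;> simp [matI, matZ, Matrix.mul_apply, Fin.sum_univ_four]

theorem matJ_mul_matZ (lam mu : ℝ) (z : ℂ) : matJ lam mu z * matZ = matZ * matJ lam mu z := by
  ext i j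
  fin_cases i <;> fin_cases j <;> simp [matJ, matZ, Matrix.mul_apply, Fin.sum_univ_four]

/-- `matZ` commutes with every term, so `w` and `w'` disappear: the commutator of two elements of
u(2) lies in su(2). -/
theorem commutator_eq {lam mu : ℝ} (hlm : lam * mu = 1) (s w s' w' : ℝ) (z z' : ℂ) :
    (s • matI + w • matZ + matJ lam mu z) * (s' • matI + w' • matZ + matJ lam mu z') -
      (s' • matI + w' • matZ + matJ lam mu z') * (s • matI + w • matZ + matJ lam mu z) =
    (2 * (z.im * z'.re - z.re * z'.im)) • matI +
      matJ lam mu (((2 * s : ℝ) : ℂ) * (-Complex.I * z') +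
        ((-2 * s' : ℝ) : ℂ) * (-Complex.I * z)) := by
  rw [matJ_add, matJ_smul, matJ_smul, ← matJ_mul_matJ_sub hlm]
  simp only [mul_add, add_mul, smul_mul_assoc, mul_smul_comm, matI_mul_matZ, matJ_mul_matZ,
    matI_mul_matJ, matJ_mul_matI]
  module

theorem endAt_mem_stdSpan (lam mu : ℝ) {m : M} (a : SO7) (ha : (a : M) = m) (c s : ℝ) (z : ℂ) :
    c • endAt a ha (s • matI + matJ lam mu z) ∈ stdSpan lam mu a ha := by
  rw [map_add, map_smul]
  exact Submodule.smul_mem _ _ (add_mem (Submodule.smul_mem _ _ (endAt_matI_mem _ _ _ _))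
    (endAt_matJ_mem _ _ _ _ _))

/-! ### Dimension and skewness of quaternionic fibres. -/

theorem finrank_span_triple {V : Type*} [AddCommGroup V] [Module ℝ V] {I J K : V}
    (h : LinearIndependent ℝ ![I, J, K]) :
    Module.finrank ℝ (Submodule.span ℝ {I, J, K}) = 3 := by
  have e : ({I, J, K} : Set V) = Set.range ![I, J, K] := by
    ext x
    simp [eq_comm]
    tauto
  rw [e, finrank_span_eq_card h, Fintype.card_fin]

theorem IsQuaternionicTriple.finrank_span {V : Type*} [AddCommGroup V] [Module ℝ V] [Nontrivial V]
    {g : LinearMap.BilinForm ℝ V} {I J K : Module.End ℝ V} (h : IsQuaternionicTriple g I J K) :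
    Module.finrank ℝ (Submodule.span ℝ {I, J, K}) = 3 :=
  finrank_span_triple h.linearIndependent

instance nontrivial_tangent (m : M) : Nontrivial (T m) := by
  obtain ⟨a, rfl⟩ := exists_lift m
  exact ⟨_, _, frame_ne_zero a (0, 0)⟩

theorem AQHStructure.exists_triple (Q : AQHStructure) (m : M) : ∃ I J K : Module.End ℝ (T m),
    IsQuaternionicTriple (Q.g.inner m) I J K ∧ Q.G m = Submodule.span ℝ {I, J, K} := by
  obtain ⟨U, I, J, K, -, h1, -, -, -, hU⟩ := Q.local_basis m
  exact ⟨_, _, _, (hU m h1).1, (hU m h1).2.2⟩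

theorem AQHStructure.finrank_eq (Q : AQHStructure) (m : M) : Module.finrank ℝ (Q.G m) = 3 := by
  obtain ⟨I, J, K, h, e⟩ := Q.exists_triple m
  rw [e, h.finrank_span]

theorem finrank_stdSpan {g : RiemMetric} {lam mu : ℝ} (h : g.IsStandard lam mu)
    (hlm : lam * mu = 1) (a : SO7) :
    Module.finrank ℝ (stdSpan lam mu a (rfl : (a : M) = a)) = 3 := by
  have hz : (1 : ℂ) * star 1 = 1 := by simp
  rw [stdSpan_eq_span a rfl hz, (isQuaternionicTriple_endAt h hlm a hz).finrank_span]

theorem mem_fixer_of_finrank_eq {W : Type*} [AddCommGroup W] [Module ℝ W]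
    {ρ : U3 →* Module.End ℝ (Module.End ℝ W)} {G : Submodule ℝ (Module.End ℝ W)}
    (hfin : Module.finrank ℝ G = 3) (hG : ∀ h, ∀ x ∈ G, ρ h x ∈ G) :
    elT ∈ fixer ρ G ∧ elS ∈ fixer ρ G := by
  have : FiniteDimensional ℝ G := Module.finite_of_finrank_pos (by omega)
  exact mem_fixer_of_finrank hfin.le hG

theorem eq_of_le_of_finrank_eq_three {W : Type*} [AddCommGroup W] [Module ℝ W]
    {G G' : Submodule ℝ (Module.End ℝ W)} (hle : G ≤ G') (h : Module.finrank ℝ G = 3)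
    (h' : Module.finrank ℝ G' = 3) : G = G' := by
  have : FiniteDimensional ℝ G' := Module.finite_of_finrank_pos (by omega)
  exact Submodule.eq_of_le_of_finrank_le hle (by omega)

theorem eq_half_commutator {W A : Type*} [AddCommGroup W] [Module ℝ W] [Ring A] [Algebra ℝ A]
    (φ : A →ₐ[ℝ] Module.End ℝ W) {x y : A} {X Y Z : Module.End ℝ W} (hx : X = φ x) (hy : Y = φ y)
    (h : X * Y = Z) (h' : Y * X = -Z) : Z = (1 / 2 : ℝ) • φ (x * y - y * x) := by
  rw [map_sub, map_mul, map_mul, ← hx, ← hy, h, h']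
  module

theorem skew_of_compat {V : Type*} [AddCommGroup V] [Module ℝ V] {g : LinearMap.BilinForm ℝ V}
    {I : Module.End ℝ V} (hI : I * I = -1) (hc : ∀ X Y, g (I X) (I Y) = g X Y) (X Y : V) :
    g (I X) Y = -g X (I Y) := by
  have := hc X (I Y)
  rw [← Module.End.mul_apply, hI] at this
  simpa [neg_eq_iff_eq_neg] using this

theorem IsQuaternionicTriple.K_compat {V : Type*} [AddCommGroup V] [Module ℝ V]
    {g : LinearMap.BilinForm ℝ V} {I J K : Module.End ℝ V} (h : IsQuaternionicTriple g I J K)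
    (X Y : V) : g (K X) (K Y) = g X Y := by
  rw [← h.I_mul_J, Module.End.mul_apply, Module.End.mul_apply, h.I_compat, h.J_compat]

theorem RiemMetric.IsStandard.entry_skew {g : RiemMetric} {lam mu : ℝ} (h : g.IsStandard lam mu)
    {Z : Module.End ℝ (T ((1 : SO7) : M))} (hZ : ∀ X Y, g.inner _ (Z X) Y = -g.inner _ X (Z Y))
    (i j : Fin 4 × Fin 3) : wt lam mu i.1 * entry Z i j = -(wt lam mu j.1 * entry Z j i) := by
  have key : ∀ (k : Fin 4 × Fin 3) (X : T ((1 : SO7) : M)), g.inner _ (frame 1 k) X =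
      wt lam mu k.1 * (frameBasis 1).repr X k := fun k X => by
    rw [h, Ad_inv_frame, metricForm_basisM_left]
    rfl
  have := hZ (frame 1 i) (frame 1 j)
  rw [g.symm, key, key] at this
  rw [entry, entry, this, neg_neg]

/-- On the block of the first complex coordinate, `elT` acts precisely as `matZ`. -/
theorem matZ_mul_entry {Z : Module.End ℝ (T ((1 : SO7) : M))}
    (hT : isotropy elT * Z = Z * isotropy elT) :
    matZ * (of fun i j => entry Z (i, 0) (j, 0)) =
      (of fun i j => entry Z (i, 0) (j, 0)) * matZ := by
  ext i j
  have key := entry_frame_permute hT (Function.LeftInverse.injective permT_permT) isotropy_elT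
    -- The second index is the partner of `j` under `elT`, so `key` relates the entries that occur
    -- in position `(i, j)` of both products.
    (i, 0) (![1, 0, 3, 2] j, 0)
  fin_cases i <;> fin_cases j <;>
    simp [matZ, signT, permT, Matrix.mul_apply, Fin.sum_univ_four] at key ⊢ <;>
    linarith

/-- Commuting with `elT` and `elS` and skewness alone still allow a component along `matZ`. Writing
each of I, J, K as half a commutator of the other two eliminates it. -/
theorem AQHStructure.IsInvariant.base_eq {Q : AQHStructure} (hQ : Q.IsInvariant) {lam mu : ℝ}
    (h : Q.g.IsStandard lam mu) (hlm : lam * mu = 1) :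
    Q.G ((1 : SO7) : M) = stdSpan lam mu 1 rfl := by
  obtain ⟨I, J, K, ht, hspan⟩ := Q.exists_triple ((1 : SO7) : M)
  obtain ⟨fT, fS⟩ := mem_fixer_of_finrank_eq (Q.finrank_eq _) hQ.isotropyConj_mem
  have std : ∀ Z ∈ Q.G ((1 : SO7) : M), Z * Z = -1 →
      (∀ X Y, Q.g.inner _ (Z X) (Z Y) = Q.g.inner _ X Y) →
      ∃ (s w : ℝ) (z : ℂ), Z = endAt 1 rfl (s • matI + w • matZ + matJ lam mu z) := by
    intro Z hZ hsq hc
    have cT := commute_of_isotropyConj (fT Z hZ)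
    have cS := commute_of_isotropyConj (fS Z hZ)
    obtain ⟨s, w, z, e⟩ := eq_of_skew_of_commute h.pos_left h.pos_right hlm (matZ_mul_entry cT)
      fun i j => h.entry_skew (skew_of_compat hsq hc) (i, 0) (j, 0)
    exact ⟨s, w, z, by rw [← e]; exact eq_endAt_of_commute cT cS⟩
  have hI : I ∈ Q.G ((1 : SO7) : M) := hspan ▸ Submodule.subset_span (by simp)
  have hJ : J ∈ Q.G ((1 : SO7) : M) := hspan ▸ Submodule.subset_span (by simp)
  have hK : K ∈ Q.G ((1 : SO7) : M) := hspan ▸ Submodule.subset_span (by simp)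
  obtain ⟨s1, w1, z1, e1⟩ := std I hI ht.I_sq ht.I_compat
  obtain ⟨s2, w2, z2, e2⟩ := std J hJ ht.J_sq ht.J_compat
  obtain ⟨s3, w3, z3, e3⟩ := std K hK ht.K_sq ht.K_compat
  refine eq_of_le_of_finrank_eq_three ?_ (Q.finrank_eq _) (finrank_stdSpan h hlm 1)
  rw [hspan, Submodule.span_le]
  rintro x (rfl | rfl | rfl)
  · rw [eq_half_commutator _ e2 e3 ht.J_mul_K ht.K_mul_J, commutator_eq hlm]
    exact endAt_mem_stdSpan _ _ _ _ _ _ _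
  · rw [eq_half_commutator _ e3 e1 ht.K_mul_I ht.I_mul_K, commutator_eq hlm]
    exact endAt_mem_stdSpan _ _ _ _ _ _ _
  · rw [eq_half_commutator _ e1 e2 ht.I_mul_J ht.J_mul_I, commutator_eq hlm]
    exact endAt_mem_stdSpan _ _ _ _ _ _ _

theorem AQHStructure.IsInvariant.isStandard {Q : AQHStructure} (hQ : Q.IsInvariant) {lam mu : ℝ}
    (h : Q.g.IsStandard lam mu) (hlm : lam * mu = 1) : Q.IsStandard lam mu := by
  refine (isStandard_iff h hlm).2 fun a => ?_
  have : ∀ c : SO7, c = a * 1 → Q.G c = stdSpan lam mu c rfl := by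
    rintro _ rfl
    refine (hQ.2 a ((1 : SO7) : M)).symm.trans ?_
    rw [hQ.base_eq h hlm]
    exact map_push_stdSpan lam mu rfl a rfl
  exact this a (mul_one a).symm

theorem AQHStructure.isInvariant_and_isNormalised_iff (Q : AQHStructure) :
    Q.IsInvariant ∧ Q.g.IsNormalised ↔
      ∃ lam mu : ℝ, 0 < lam ∧ 0 < mu ∧ lam * mu = 1 ∧ Q.IsStandard lam mu := by
  constructor
  · rintro ⟨hQ, hn⟩
    obtain ⟨lam, mu, hl, hm, hlm, h⟩ := (Q.g.isInvariant_and_isNormalised_iff).1 ⟨hQ.1, hn⟩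
    exact ⟨lam, mu, hl, hm, hlm, hQ.isStandard h hlm⟩
  · rintro ⟨lam, mu, -, -, hlm, h⟩
    exact ⟨h.isInvariant, h.1.isNormalised_iff.2 hlm⟩

end TwistorS6

end

theorem mainTheorem2 :
    -- the triple with parameters `lam`, `mu` gives an almost quaternion-Hermitian structure exactly
    -- for positive `lam`, `mu` with `lam * mu = 1`
    (∀ lam mu : ℝ, (∃ Q : TwistorS6.AQHStructure, Q.IsStandard lam mu) ↔
      0 < lam ∧ 0 < mu ∧ lam * mu = 1) ∧
    -- and then only one structure
    (∀ (lam mu : ℝ) (Q Q' : TwistorS6.AQHStructure),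
      Q.IsStandard lam mu → Q'.IsStandard lam mu → Q = Q') ∧
    -- these are exactly the invariant structures with normalised volume
    (∀ Q : TwistorS6.AQHStructure, Q.IsInvariant ∧ Q.g.IsNormalised ↔
      ∃ lam mu : ℝ, 0 < lam ∧ 0 < mu ∧ lam * mu = 1 ∧ Q.IsStandard lam mu) ∧
    -- with parameters determined by the structure, even by its metric
    (∀ (g : TwistorS6.RiemMetric) (lam mu lam' mu' : ℝ),
      g.IsStandard lam mu → g.IsStandard lam' mu' → lam = lam' ∧ mu = mu') ∧
    -- and the metrics are exactly the invariant metrics with normalised volume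
    (∀ g : TwistorS6.RiemMetric, g.IsInvariant ∧ g.IsNormalised ↔
      ∃ lam mu : ℝ, 0 < lam ∧ 0 < mu ∧ lam * mu = 1 ∧ g.IsStandard lam mu) ∧
    (∀ lam mu : ℝ, 0 < lam → 0 < mu → lam * mu = 1 →
      ∃! g : TwistorS6.RiemMetric, g.IsStandard lam mu) := by
  refine ⟨fun lam mu => ⟨?_, ?_⟩, fun _ _ _ _ h h' => h.ext h',
    TwistorS6.AQHStructure.isInvariant_and_isNormalised_iff, fun _ _ _ _ _ h h' => h.parameters h',
    TwistorS6.RiemMetric.isInvariant_and_isNormalised_iff, fun lam mu hl hm _ => ?_⟩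
  · rintro ⟨Q, h⟩
    exact ⟨h.1.pos_left, h.1.pos_right, h.mul_eq_one⟩
  · rintro ⟨hl, hm, hlm⟩
    exact ⟨_, TwistorS6.stdStructure_isStandard hl hm hlm⟩
  · exact ⟨_, TwistorS6.stdMetric_isStandard hl hm,
      fun _ h => h.ext (TwistorS6.stdMetric_isStandard hl hm)⟩
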